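/- Let $\tau\neq 0$ and let $\mathbb H_3(\tau)$ be $\mathbb R^3$ with the Lorentzian metric $g_\tau=dx^2+dy^2-(dz-\tau(y\,dx-x\,dy))^2$ and the orthonormal frame $E_1=\partial_x+\tau y\,\partial_z$, $E_2=\partial_y-\tau x\,\partial_z$, $E_3=\partial_z$. Let $U\wedge V=(u_2v_3-u_3v_2)E_1-(u_1v_3-u_3v_1)E_2-(u_1v_2-u_2v_1)E_3$ be the cross product. Let $\mathcal M$ be a timelike surface smoothly immersed in $\mathbb H_3(\tau)$, with smooth unit normal field $N$, $g_\tau(N,N)=1$, and suppose that $\mathcal M$ is a helix surface with constant hyperbolic angle $\vartheta\neq0$, that is $\nu:=g_\tau(N,E_3)\,g_\tau(N,N)=\sinh\vartheta$ at every point. Let $T=E_3-\nu N$ be the tangential part of $E_3$ and $JT=N\wedge T$. Around every point of $\mathcal M$ there are local coordinates $(u,v)\in I\times J$ ($I,J$ open intervals) and a smooth function $\eta$ on $J$ such that $$\partial_u=T,\qquad \partial_v=-\frac{\sin(\eta(v)-2\tau\sinh^2\vartheta\,u)}{\sinh\vartheta}\,T+\cos(\eta(v)-2\tau\sinh^2\vartheta\,u)\,JT.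 \qquad (*)$$ For any local coordinates $(u,v)\in I\times J$ on $\mathcal M$ satisfying $(*)$ for some smooth $\eta$, there are a constant $c\in\mathbb R$ and smooth functions $f_1,f_2,f_3$ on $J$ with $$f_1'(v)^2+f_2'(v)^2=\cosh^2\vartheta,\qquad f_3'(v)=\tau\,\bigl(f_2(v)f_1'(v)-f_1(v)f_2'(v)\bigr),$$ such that, with $\varphi(u)=2\tau\sinh^2\vartheta\,u+c$, the position vector $F$ of $\mathcal M$ in $\mathbb R^3$ is $$F(u,v)=\Bigl(-\tfrac{\coth\vartheta}{2\tau}\sin\varphi(u)+f_1(v),\ \tfrac{\coth\vartheta}{2\tau}\cos\varphi(u)+f_2(v),\ \tfrac{\cosh^2\vartheta}{2}\,u-\tfrac{\coth\vartheta}{2}\bigl[f_1(v)\cos\varphi(u)+f_2(v)\sin\varphi(u)\bigr]+f_3(v)\Bigr).$$ Equivalently, in the coordinates $(s,v)$ with $s=\varphi(u)$, and with $\tilde f_3=f_3-\tfrac{\coth^2\vartheta}{4\tau}c$ (which has the same derivative as $f_3$), the surface is parametrized by $$\Bigl(-\tfrac{\coth\vartheta}{2\tau}\sin s+f_1(v),\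 \tfrac{\coth\vartheta}{2\tau}\cos s+f_2(v),\ \tfrac{\coth^2\vartheta}{4\tau}\,s-\tfrac{\coth\vartheta}{2}\bigl[f_1(v)\cos s+f_2(v)\sin s\bigr]+\tilde f_3(v)\Bigr).$$ -/

import Mathlib

open scoped Manifold ContDiff

noncomputable section

namespace LorentzHeisenberg

/-- The space `ℝ³`, underlying the Heisenberg group. Its points and its tangent vectors are written
in the coordinates `(x, y, z)`; the Euclidean norm plays no role. -/
abbrev R3 : Type := EuclideanSpace ℝ (Fin 3)

/-- The plane `ℝ²`, on which surfaces are modelled. -/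
abbrev R2 : Type := EuclideanSpace ℝ (Fin 2)

/-- The one-form `dz - τ (y dx - x dy)` at the point `p`, evaluated at the tangent vector `X`. -/
def contact (τ : ℝ) (p X : R3) : ℝ := X 2 - τ * (p 1 * X 0 - p 0 * X 1)

/-- The Lorentzian metric `g_τ = dx² + dy² - (dz - τ (y dx - x dy))²` at the point `p`. -/
def metric (τ : ℝ) (p X Y : R3) : ℝ :=
  X 0 * Y 0 + X 1 * Y 1 - contact τ p X * contact τ p Y

/-- `E₁ = ∂_x + τ y ∂_z` at the point `p`. -/
def E1 (τ : ℝ) (p : R3) : R3 := !₂[1, 0, τ * p 1]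

/-- `E₂ = ∂_y - τ x ∂_z` at the point `p`. -/
def E2 (τ : ℝ) (p : R3) : R3 := !₂[0, 1, -(τ * p 0)]

/-- The vertical field `E₃ = ∂_z`. -/
def E3 : R3 := !₂[0, 0, 1]

/-- The components of a tangent vector at `p` in the frame `E₁, E₂, E₃` are
`X 0`, `X 1` and `contact τ p X`. -/
theorem eq_frame (τ : ℝ) (p X : R3) :
    X = X 0 • E1 τ p + X 1 • E2 τ p + contact τ p X • E3 := by
  ext i
  fin_cases i <;> simp [E1, E2, E3, contact] <;> ring

/-- The cross product `U ∧ V` at the point `p`: in terms of the components in `E₁, E₂, E₃`,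
`(u₂ v₃ - u₃ v₂) E₁ - (u₁ v₃ - u₃ v₁) E₂ - (u₁ v₂ - u₂ v₁) E₃`. -/
def cross (τ : ℝ) (p U V : R3) : R3 :=
  (U 1 * contact τ p V - contact τ p U * V 1) • E1 τ p
    - (U 0 * contact τ p V - contact τ p U * V 0) • E2 τ p
    - (U 0 * V 1 - U 1 * V 0) • E3

section Surface

variable {M : Type*} [TopologicalSpace M] [ChartedSpace R2 M]

/-- The differential of `Φ : M → ℝ³` at `p`, with values in `ℝ³`. -/
def push (Φ : M → R3) (p : M) (X : TangentSpace 𝓘(ℝ, R2) p) : R3 :=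
  mfderiv 𝓘(ℝ, R2) 𝓘(ℝ, R3) Φ p X

/-- `Φ` is a smooth immersion of the surface `M` into `ℝ³`. -/
structure IsImmersedSurface (Φ : M → R3) : Prop where
  smooth : ContMDiff 𝓘(ℝ, R2) 𝓘(ℝ, R3) ∞ Φ
  injective : ∀ p : M, Function.Injective (push Φ p)

/-- The metric induced on `M` by `g_τ` is Lorentzian: each tangent plane has an orthonormal basis
that consists of a spacelike and a timelike vector. -/
def IsTimelike (τ : ℝ) (Φ : M → R3) : Prop :=
  ∀ p : M, ∃ X Y : TangentSpace 𝓘(ℝ, R2) p,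
    metric τ (Φ p) (push Φ p X) (push Φ p X) = 1 ∧
    metric τ (Φ p) (push Φ p Y) (push Φ p Y) = -1 ∧
    metric τ (Φ p) (push Φ p X) (push Φ p Y) = 0

/-- `N` is a smooth unit normal field along `Φ`, with `g_τ(N, N) = ε`. -/
structure IsUnitNormal (τ ε : ℝ) (Φ N : M → R3) : Prop where
  smooth : ContMDiff 𝓘(ℝ, R2) 𝓘(ℝ, R3) ∞ N
  unit : ∀ p : M, metric τ (Φ p) (N p) (N p) = ε
  normal : ∀ (p : M) (X : TangentSpace 𝓘(ℝ, R2) p), metric τ (Φ p) (N p) (push Φ p X) = 0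

/-- The angle function `ν = g_τ(N, E₃) g_τ(N, N)`. -/
def angleFunction (τ : ℝ) (Φ N : M → R3) (p : M) : ℝ :=
  metric τ (Φ p) (N p) E3 * metric τ (Φ p) (N p) (N p)

/-- The tangential part `T = E₃ - ν N` of `E₃`, as a vector of `ℝ³`. -/
def tangentPart (τ : ℝ) (Φ N : M → R3) (p : M) : R3 :=
  E3 - angleFunction τ Φ N p • N p

/-- The rotated field `JT = N ∧ T`, as a vector of `ℝ³`. -/
def rotatedPart (τ : ℝ) (Φ N : M → R3) (p : M) : R3 :=
  cross τ (Φ p) (N p) (tangentPart τ Φ N p)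

/-- `M`, immersed by `Φ` and oriented by the unit normal `N`, is a timelike helix surface
with constant hyperbolic angle `ϑ`: the function `ν` is the constant `sinh ϑ`. -/
structure IsTimelikeHelixSurface (τ ϑ : ℝ) (Φ N : M → R3) : Prop where
  immersed : IsImmersedSurface Φ
  timelike : IsTimelike τ Φ
  unitNormal : IsUnitNormal τ 1 Φ N
  angle : ∀ p : M, angleFunction τ Φ N p = Real.sinh ϑ

/-- `X` is a system of local coordinates `(u, v)` on `M`, defined on the product `I × J` of two
open intervals (bounded or not), with `∂_u = T` and `∂_v = a T + b JT`, where
`a = - sin (η(v) - 2 τ sinh²ϑ u) / sinh ϑ` and `b = cos (η(v) - 2 τ sinh²ϑ u)`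
for the smooth function `η` on `J`. -/
structure IsAdaptedCoordinates (τ ϑ : ℝ) (Φ N : M → R3) (I J : Set ℝ) (η : ℝ → ℝ)
    (X : PartialDiffeomorph 𝓘(ℝ, ℝ × ℝ) 𝓘(ℝ, R2) (ℝ × ℝ) M ∞) : Prop where
  isOpen_fst : IsOpen I
  isOpen_snd : IsOpen J
  ordConnected_fst : I.OrdConnected
  ordConnected_snd : J.OrdConnected
  source_eq : X.source = I ×ˢ J
  smooth_eta : ContDiffOn ℝ ∞ η J
  partial_u : ∀ u ∈ I, ∀ v ∈ J,
    fderiv ℝ (fun w : ℝ × ℝ => Φ (X w)) (u, v) (1, 0) = tangentPart τ Φ N (X (u, v))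
  partial_v : ∀ u ∈ I, ∀ v ∈ J,
    fderiv ℝ (fun w : ℝ × ℝ => Φ (X w)) (u, v) (0, 1) =
      (-(Real.sin (η v - 2 * τ * Real.sinh ϑ ^ 2 * u) / Real.sinh ϑ)) •
          tangentPart τ Φ N (X (u, v))
        + Real.cos (η v - 2 * τ * Real.sinh ϑ ^ 2 * u) • rotatedPart τ Φ N (X (u, v))

end Surface

/-- The hyperbolic cotangent. -/
def coth (x : ℝ) : ℝ := Real.cosh x / Real.sinh x

end LorentzHeisenberg

end

open LorentzHeisenberg

noncomputable section

namespace LorentzHeisenberg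

/-! Everything is computed in the frame `E₁, E₂, E₃`, without a connection. Write ω for the contact
form. The helix condition says ω(N) = -sinh ϑ, so the horizontal part (n₀, n₁) of N has length cosh
ϑ, and normality reads n₀ dx + n₁ dy + sinh ϑ ω = 0 along the surface. Since dω = 2τ dx ∧ dy, the
exterior derivative of this relation (`IsHelixPatch.codazzi`) is the only structure equation that is
needed. The field T has horizontal part -sinh ϑ (n₀, n₁) and ω(T) = cosh²ϑ; JT is horizontal, equal
to (n₁, -n₀).

Parametrization: in adapted coordinates the structure equation and the equality of mixed partials
force (n₀, n₁) to rotate with speed k = 2τ sinh²ϑ in u and to be constant in v (`fderiv_normal`).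
Hence (n₀, n₁) = cosh ϑ (cos φ, sin φ) with φ = ku + c (`exists_phase`). Then ∂_u F = T integrates
explicitly, with f₁, f₂, f₃ as constants of integration, and ∂_v F on a single slice gives the
conditions on their derivatives (`exists_parametrization`).

Existence: a local angle θ of (n₀, n₁) satisfies T(θ) = k (`fderiv_angle`), so θ/k can serve as u. A
first integral of T completes it to coordinates with ∂_u = T, by the inverse function theorem
(`IsHelixPatch.exists_vertical_coordinates`). The horizontal part of ∂_v then depends on v only.
After reparametrizing v so that this part has length cosh ϑ, its angle is η, and normality recovers
the vertical component (`exists_eta`). -/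

/-- Tangent vectors agree as soon as their components in the frame `E₁, E₂, E₃` agree. -/
theorem ext_frame {τ : ℝ} {p X Y : R3} (h0 : X 0 = Y 0) (h1 : X 1 = Y 1)
    (h2 : contact τ p X = contact τ p Y) : X = Y := by
  rw [eq_frame τ p X, eq_frame τ p Y, h0, h1, h2]

/-- The differential data of a helix surface in a chart with domain `U ⊆ E`: an immersion `F` with
normal field `N` whose components in the frame `E₁, E₂, E₃` are `N 0`, `N 1` and `-sinh ϑ`. -/
structure IsHelixPatch {E : Type*} [NormedAddCommGroup E] [NormedSpace ℝ E]
    (τ ϑ : ℝ) (F N : E → R3) (U : Set E) : Prop where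
  isOpen : IsOpen U
  smooth : ContDiffOn ℝ ∞ F U
  smooth_normal : ContDiffOn ℝ ∞ N U
  injective : ∀ q ∈ U, Function.Injective (fderiv ℝ F q)
  contact_normal : ∀ q ∈ U, contact τ (F q) (N q) = -Real.sinh ϑ
  sq_add_sq : ∀ q ∈ U, N q 0 ^ 2 + N q 1 ^ 2 = Real.cosh ϑ ^ 2
  normal : ∀ q ∈ U, ∀ a, N q 0 * fderiv ℝ F q a 0 + N q 1 * fderiv ℝ F q a 1
    + Real.sinh ϑ * contact τ (F q) (fderiv ℝ F q a) = 0

/-! ### Frame components of T and JT. -/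

section Frame

variable {τ ϑ : ℝ} {p n : R3}

theorem vertical_sub_zero (s : ℝ) : (E3 - s • n) 0 = -(s * n 0) := by simp [E3]

theorem vertical_sub_one (s : ℝ) : (E3 - s • n) 1 = -(s * n 1) := by simp [E3]

theorem contact_vertical_sub (h : contact τ p n = -Real.sinh ϑ) :
    contact τ p (E3 - Real.sinh ϑ • n) = Real.cosh ϑ ^ 2 := by
  rw [Real.cosh_sq]
  simp only [contact, E3, PiLp.sub_apply, PiLp.smul_apply, smul_eq_mul] at h ⊢
  simp
  linear_combination -Real.sinh ϑ * h

/-- The factor multiplying the horizontal part of n is cosh²ϑ - sinh²ϑ = 1, so JT is exactly a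
quarter turn of that part. It has no vertical component because the horizontal parts of n and T are
parallel. -/
theorem cross_zero (h : contact τ p n = -Real.sinh ϑ) :
    cross τ p n (E3 - Real.sinh ϑ • n) 0 = n 1 := by
  simp only [cross, contact_vertical_sub h, vertical_sub_one, h, Real.cosh_sq]
  simp [E1, E2, E3]; ring

theorem cross_one (h : contact τ p n = -Real.sinh ϑ) :
    cross τ p n (E3 - Real.sinh ϑ • n) 1 = -n 0 := by
  simp only [cross, contact_vertical_sub h, vertical_sub_zero, h, Real.cosh_sq]
  simp [E1, E2, E3]; ring

theorem contact_cross :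
    contact τ p (cross τ p n (E3 - Real.sinh ϑ • n)) = 0 := by
  simp only [cross, vertical_sub_zero, vertical_sub_one]
  simp [contact, E1, E2, E3]; ring

theorem contact_add (X Y : R3) : contact τ p (X + Y) = contact τ p X + contact τ p Y := by
  simp [contact]; ring

theorem contact_smul (a : ℝ) (X : R3) : contact τ p (a • X) = a * contact τ p X := by
  simp [contact]; ring

end Frame

/-! ### Directional derivatives and their symmetry. -/

section Calculus

variable {E G : Type*} [NormedAddCommGroup E] [NormedSpace ℝ E]
  [NormedAddCommGroup G] [NormedSpace ℝ G]

theorem hasDerivAt_line {f : E → G} {q : E} (h : DifferentiableAt ℝ f q) (a : E) :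
    HasDerivAt (fun t : ℝ => f (q + t • a)) (fderiv ℝ f q a) 0 := by
  have h1 : HasFDerivAt f (fderiv ℝ f q) (q + (0 : ℝ) • a) := by simpa using h.hasFDerivAt
  have h2 : HasDerivAt (fun t : ℝ => q + t • a) a 0 := by
    simpa using ((hasDerivAt_id (0 : ℝ)).smul_const a).const_add q
  exact h1.comp_hasDerivAt (0 : ℝ) h2

theorem _root_.HasDerivAt.apply_R3 {f : ℝ → R3} {f' : R3} {t : ℝ} (h : HasDerivAt f f' t) (i : Fin 3) :
    HasDerivAt (fun s => f s i) (f' i) t :=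
  (EuclideanSpace.proj i : R3 →L[ℝ] ℝ).hasFDerivAt.comp_hasDerivAt t h

theorem eventually_line {q : E} {U : Set E} (hU : IsOpen U) (hq : q ∈ U) (a : E) :
    ∀ᶠ t : ℝ in nhds 0, q + t • a ∈ U := by
  have : ContinuousAt (fun t : ℝ => q + t • a) 0 := by fun_prop
  exact this (hU.mem_nhds (by simpa using hq))

theorem differentiableAt_fderiv_apply {f : E → G} {U : Set E} (hU : IsOpen U)
    (hf : ContDiffOn ℝ ∞ f U) {q : E} (hq : q ∈ U) (a : E) :
    DifferentiableAt ℝ (fun x => fderiv ℝ f x a) q :=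
  ((((contDiffOn_infty_iff_fderiv_of_isOpen hU).1 hf).2.contDiffAt (hU.mem_nhds hq)).differentiableAt
    (by simp)).clm_apply (differentiableAt_const a)

/-- Schwarz's theorem for directional derivatives. -/
theorem fderiv_fderiv_comm {f : E → G} {U : Set E} (hU : IsOpen U)
    (hf : ContDiffOn ℝ ∞ f U) {q : E} (hq : q ∈ U) (a b : E) :
    fderiv ℝ (fun x => fderiv ℝ f x a) q b = fderiv ℝ (fun x => fderiv ℝ f x b) q a := by
  have hd : DifferentiableAt ℝ (fderiv ℝ f) q :=
    (((contDiffOn_infty_iff_fderiv_of_isOpen hU).1 hf).2.contDiffAt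
      (hU.mem_nhds hq)).differentiableAt (by simp)
  have hs : IsSymmSndFDerivAt ℝ f q :=
    (hf.contDiffAt (hU.mem_nhds hq)).isSymmSndFDerivAt
      (by simpa using WithTop.coe_le_coe.2 (le_top : (2 : ℕ∞) ≤ ⊤))
  have key : ∀ c d : E, fderiv ℝ (fun x => fderiv ℝ f x c) q d = fderiv ℝ (fderiv ℝ f) q d c := by
    intro c d
    rw [(hd.hasFDerivAt.clm_apply (hasFDerivAt_const c q)).fderiv]
    simp
  rw [key, key, hs.eq]

end Calculus

/-! ### The structure equation and the tangent plane. -/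

namespace IsHelixPatch

variable {E : Type*} [NormedAddCommGroup E] [NormedSpace ℝ E]
  {τ ϑ : ℝ} {F N : E → R3} {U : Set E} {q : E}

theorem differentiableAt (h : IsHelixPatch τ ϑ F N U) (hq : q ∈ U) : DifferentiableAt ℝ F q :=
  (h.smooth.contDiffAt (h.isOpen.mem_nhds hq)).differentiableAt (by simp)

theorem differentiableAt_normal (h : IsHelixPatch τ ϑ F N U) (hq : q ∈ U) :
    DifferentiableAt ℝ N q :=
  (h.smooth_normal.contDiffAt (h.isOpen.mem_nhds hq)).differentiableAt (by simp)

/-- The horizontal part of the normal has constant length. -/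
theorem normal_mul_fderiv_normal (h : IsHelixPatch τ ϑ F N U) (hq : q ∈ U) (a : E) :
    N q 0 * fderiv ℝ N q a 0 + N q 1 * fderiv ℝ N q a 1 = 0 := by
  have hN := hasDerivAt_line (h.differentiableAt_normal hq) a
  have h1 := ((hN.apply_R3 0).pow 2).add ((hN.apply_R3 1).pow 2)
  have h2 := h1.unique ((hasDerivAt_const (0 : ℝ) (Real.cosh ϑ ^ 2)).congr_of_eventuallyEq
    ((eventually_line h.isOpen hq a).mono fun t ht => h.sq_add_sq _ ht))
  simp at h2
  linarith

/-- The exterior derivative of the normality relation. -/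
theorem codazzi (h : IsHelixPatch τ ϑ F N U) (hq : q ∈ U) (a b : E) :
    fderiv ℝ N q a 0 * fderiv ℝ F q b 0 - fderiv ℝ N q b 0 * fderiv ℝ F q a 0
      + (fderiv ℝ N q a 1 * fderiv ℝ F q b 1 - fderiv ℝ N q b 1 * fderiv ℝ F q a 1)
      + 2 * τ * Real.sinh ϑ * (fderiv ℝ F q a 0 * fderiv ℝ F q b 1
        - fderiv ℝ F q b 0 * fderiv ℝ F q a 1) = 0 := by
  have key : ∀ c d : E, fderiv ℝ N q c 0 * fderiv ℝ F q d 0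
      + N q 0 * fderiv ℝ (fun x => fderiv ℝ F x d) q c 0
      + (fderiv ℝ N q c 1 * fderiv ℝ F q d 1
      + N q 1 * fderiv ℝ (fun x => fderiv ℝ F x d) q c 1)
      + Real.sinh ϑ * (fderiv ℝ (fun x => fderiv ℝ F x d) q c 2
      - τ * (fderiv ℝ F q c 1 * fderiv ℝ F q d 0
        + F q 1 * fderiv ℝ (fun x => fderiv ℝ F x d) q c 0
        - (fderiv ℝ F q c 0 * fderiv ℝ F q d 1
        + F q 0 * fderiv ℝ (fun x => fderiv ℝ F x d) q c 1))) = 0 := by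
    intro c d
    have hN := hasDerivAt_line (h.differentiableAt_normal hq) c
    have hF := hasDerivAt_line (h.differentiableAt hq) c
    have hD := hasDerivAt_line (differentiableAt_fderiv_apply h.isOpen h.smooth hq d) c
    have h1 := (((hN.apply_R3 0).mul (hD.apply_R3 0)).add ((hN.apply_R3 1).mul (hD.apply_R3 1))).add
      (((hD.apply_R3 2).sub ((((hF.apply_R3 1).mul (hD.apply_R3 0)).sub
        ((hF.apply_R3 0).mul (hD.apply_R3 1))).const_mul τ)).const_mul (Real.sinh ϑ))
    have h2 := h1.unique ((hasDerivAt_const (0 : ℝ) (0 : ℝ)).congr_of_eventuallyEq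
      ((eventually_line h.isOpen hq c).mono fun t ht => h.normal _ ht d))
    simpa using h2
  -- Antisymmetrizing in a and b cancels all second derivatives of F; what remains of ω is its
  -- exterior derivative 2τ dx ∧ dy.
  have h1 := key a b
  have h2 := key b a
  rw [fderiv_fderiv_comm h.isOpen h.smooth hq a b] at h2
  linear_combination h1 - h2

/-- On a surface, every vector normal to `N` is tangent. -/
theorem exists_fderiv_eq (h : IsHelixPatch τ ϑ F N U) (hE : Module.finrank ℝ E = 2) (hϑ : ϑ ≠ 0)
    (hq : q ∈ U) {Y : R3}
    (hY : N q 0 * Y 0 + N q 1 * Y 1 + Real.sinh ϑ * contact τ (F q) Y = 0) :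
    ∃ a, fderiv ℝ F q a = Y := by
  have : FiniteDimensional ℝ E := Module.finite_of_finrank_eq_succ hE
  -- The conormal functional is nonzero, with value sinh ϑ on `E3`, so its kernel is a plane. The
  -- image of the differential lies in this plane and has the same dimension.
  let φ : R3 →ₗ[ℝ] ℝ :=
    { toFun := fun Y => N q 0 * Y 0 + N q 1 * Y 1 + Real.sinh ϑ * contact τ (F q) Y
      map_add' := fun X Y => by simp only [contact_add, PiLp.add_apply]; ring
      map_smul' := fun r X => by
        simp only [contact_smul, PiLp.smul_apply, smul_eq_mul, RingHom.id_apply]; ring }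
  have hS : Real.sinh ϑ ≠ 0 := by simpa using hϑ
  have hsurj : Function.Surjective φ := by
    intro r
    refine ⟨(r / Real.sinh ϑ) • E3, ?_⟩
    simp [φ, contact, E3]
    field_simp
  have hker : Module.finrank ℝ (LinearMap.ker φ) = 2 := by
    have h1 := φ.finrank_range_add_finrank_ker
    rw [LinearMap.range_eq_top.2 hsurj] at h1
    simp at h1
    omega
  have hrange : Module.finrank ℝ (LinearMap.range (fderiv ℝ F q).toLinearMap) = 2 := by
    rw [LinearMap.finrank_range_of_inj (h.injective q hq), hE]
  have hle : LinearMap.range (fderiv ℝ F q).toLinearMap ≤ LinearMap.ker φ := by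
    rintro _ ⟨a, rfl⟩
    exact h.normal q hq a
  have heq := Submodule.eq_of_le_of_finrank_eq hle (hrange.trans hker.symm)
  have : Y ∈ LinearMap.range (fderiv ℝ F q).toLinearMap := by rw [heq]; exact hY
  exact this

end IsHelixPatch

/-! ### From the surface to patches in a vector space. -/

section Pullback

variable {M : Type*} [TopologicalSpace M] [ChartedSpace R2 M]
  {E : Type*} [NormedAddCommGroup E] [NormedSpace ℝ E] {τ ϑ : ℝ} {Φ N : M → R3}

namespace IsTimelikeHelixSurface

/-- The sign comes from g(E₃, E₃) = -1, which makes g(N, E₃) the negative of the contact component.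
-/
theorem contact_normal (hM : IsTimelikeHelixSurface τ ϑ Φ N) (p : M) :
    contact τ (Φ p) (N p) = -Real.sinh ϑ := by
  have h1 := hM.angle p
  rw [angleFunction, hM.unitNormal.unit p] at h1
  simp [metric, E3, contact] at h1 ⊢
  linarith

theorem tangentPart_eq (hM : IsTimelikeHelixSurface τ ϑ Φ N) (p : M) :
    tangentPart τ Φ N p = E3 - Real.sinh ϑ • N p := by
  rw [tangentPart, hM.angle]

theorem rotatedPart_eq (hM : IsTimelikeHelixSurface τ ϑ Φ N) (p : M) :
    rotatedPart τ Φ N p = cross τ (Φ p) (N p) (E3 - Real.sinh ϑ • N p) := by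
  rw [rotatedPart, hM.tangentPart_eq]

/-- A helix surface, read in a partial diffeomorphism with values in it, is a helix patch. -/
theorem isHelixPatch (hM : IsTimelikeHelixSurface τ ϑ Φ N)
    (X : PartialDiffeomorph 𝓘(ℝ, E) 𝓘(ℝ, R2) E M ∞) :
    IsHelixPatch τ ϑ (fun w => Φ (X w)) (fun w => N (X w)) X.source := by
  have hfd : ∀ q ∈ X.source, ∀ a, fderiv ℝ (fun w => Φ (X w)) q a
      = push Φ (X q) (mfderiv 𝓘(ℝ, E) 𝓘(ℝ, R2) X q a) := by
    intro q hq a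
    have h1 : MDifferentiableAt 𝓘(ℝ, R2) 𝓘(ℝ, R3) Φ (X q) :=
      hM.immersed.smooth.mdifferentiableAt (by simp)
    have h2 : MDifferentiableAt 𝓘(ℝ, E) 𝓘(ℝ, R2) X q := X.mdifferentiableAt (by simp) hq
    have h3 := mfderiv_comp q h1 h2
    rw [← mfderiv_eq_fderiv]
    exact DFunLike.congr_fun h3 a
  refine ⟨X.open_source, ?_, ?_, ?_, fun q _ => hM.contact_normal _, ?_, ?_⟩
  · rw [← contMDiffOn_iff_contDiffOn]
    exact hM.immersed.smooth.comp_contMDiffOn X.contMDiffOn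
  · rw [← contMDiffOn_iff_contDiffOn]
    exact hM.unitNormal.smooth.comp_contMDiffOn X.contMDiffOn
  · intro q hq a b hab
    rw [hfd q hq, hfd q hq] at hab
    have hab' := hM.immersed.injective _ hab
    have hX : IsLocalDiffeomorphAt 𝓘(ℝ, E) 𝓘(ℝ, R2) ∞ X q := X.isLocalDiffeomorphAt _ _ _ hq
    have hinj := (hX.mfderivToContinuousLinearEquiv (by simp)).injective
    have hc := hX.mfderivToContinuousLinearEquiv_coe (by simp)
    have e : ∀ c, hX.mfderivToContinuousLinearEquiv (by simp) c
        = mfderiv 𝓘(ℝ, E) 𝓘(ℝ, R2) X q c := fun c => DFunLike.congr_fun hc c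
    exact hinj ((e a).trans (hab'.trans (e b).symm))
  · intro q _
    have h1 := hM.unitNormal.unit (X q)
    rw [metric, hM.contact_normal] at h1
    rw [Real.cosh_sq]
    linarith
  · intro q hq a
    have h1 := hM.unitNormal.normal (X q) (mfderiv 𝓘(ℝ, E) 𝓘(ℝ, R2) X q a)
    rw [← hfd q hq, metric, hM.contact_normal] at h1
    linarith

end IsTimelikeHelixSurface

end Pullback

/-! ### Functions on a product of intervals. -/

section Product

variable {G : Type*} [NormedAddCommGroup G] [NormedSpace ℝ G]

theorem hasDerivAt_fst {f : ℝ × ℝ → G} {u v : ℝ} (h : DifferentiableAt ℝ f (u, v)) :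
    HasDerivAt (fun s => f (s, v)) (fderiv ℝ f (u, v) (1, 0)) u :=
  HasFDerivAt.comp_hasDerivAt (f := fun s => (s, v)) u h.hasFDerivAt
    ((hasDerivAt_id u).prodMk (hasDerivAt_const u v))

theorem hasDerivAt_snd {f : ℝ × ℝ → G} {u v : ℝ} (h : DifferentiableAt ℝ f (u, v)) :
    HasDerivAt (fun s => f (u, s)) (fderiv ℝ f (u, v) (0, 1)) v :=
  HasFDerivAt.comp_hasDerivAt (f := fun s => (u, s)) v h.hasFDerivAt
    ((hasDerivAt_const v u).prodMk (hasDerivAt_id v))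

theorem contDiffOn_slice {f : ℝ × ℝ → G} {I J : Set ℝ} (hf : ContDiffOn ℝ ∞ f (I ×ˢ J)) {u : ℝ}
    (hu : u ∈ I) : ContDiffOn ℝ ∞ (fun v => f (u, v)) J :=
  hf.comp (contDiffOn_const.prodMk contDiffOn_id) fun _ hv => ⟨hu, hv⟩

theorem eq_of_hasDerivAt_zero {f : ℝ → G} {I : Set ℝ} (hI : IsOpen I) (hc : I.OrdConnected)
    (hf : ∀ u ∈ I, HasDerivAt f 0 u) {u u' : ℝ} (hu : u ∈ I) (hu' : u' ∈ I) : f u = f u' :=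
  hI.is_const_of_deriv_eq_zero hc.isPreconnected
    (fun x hx => (hf x hx).differentiableAt.differentiableWithinAt)
    (fun x hx => (hf x hx).deriv) hu hu'

end Product

theorem contDiffOn_R3_iff {E : Type*} [NormedAddCommGroup E] [NormedSpace ℝ E] {f : E → R3}
    {U : Set E} : ContDiffOn ℝ ∞ f U ↔ ∀ i, ContDiffOn ℝ ∞ (fun x => f x i) U :=
  contDiffOn_euclidean

/-! ### Derivatives of the normal in adapted coordinates. -/

namespace IsHelixPatch

variable {τ ϑ : ℝ} {F N : ℝ × ℝ → R3} {I J : Set ℝ} {η : ℝ → ℝ} {u v : ℝ}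

/-- Otherwise the two coordinate vectors would be parallel, against the injectivity of the
differential. -/
theorem cos_ne_zero (h : IsHelixPatch τ ϑ F N (I ×ˢ J)) (hu : u ∈ I) (hv : v ∈ J) {a ψ : ℝ}
    {T W : R3} (hF : fderiv ℝ F (u, v) (1, 0) = T)
    (hG : fderiv ℝ F (u, v) (0, 1) = a • T + Real.cos ψ • W) : Real.cos ψ ≠ 0 := by
  intro h0
  have h1 : fderiv ℝ F (u, v) (0, 1) = fderiv ℝ F (u, v) (a • (1, 0)) := by
    rw [hG, h0, map_smul, hF]; simp
  have h2 := h.injective _ ⟨hu, hv⟩ h1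
  simp at h2

/-- In coordinates adapted to the frame `T, JT`, the normal rotates with constant speed along the
first coordinate and is constant along the second one. -/
theorem fderiv_normal (h : IsHelixPatch τ ϑ F N (I ×ˢ J)) (hI : IsOpen I) (hϑ : ϑ ≠ 0)
    (hF : ∀ u ∈ I, ∀ v ∈ J, fderiv ℝ F (u, v) (1, 0) = E3 - Real.sinh ϑ • N (u, v))
    (hG : ∀ u ∈ I, ∀ v ∈ J, fderiv ℝ F (u, v) (0, 1) =
      (-(Real.sin (η v - 2 * τ * Real.sinh ϑ ^ 2 * u) / Real.sinh ϑ)) •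
          (E3 - Real.sinh ϑ • N (u, v))
        + Real.cos (η v - 2 * τ * Real.sinh ϑ ^ 2 * u) •
          cross τ (F (u, v)) (N (u, v)) (E3 - Real.sinh ϑ • N (u, v)))
    (hu : u ∈ I) (hv : v ∈ J) :
    (fderiv ℝ N (u, v) (1, 0) 0 = -(2 * τ * Real.sinh ϑ ^ 2) * N (u, v) 1 ∧
      fderiv ℝ N (u, v) (1, 0) 1 = 2 * τ * Real.sinh ϑ ^ 2 * N (u, v) 0) ∧
    fderiv ℝ N (u, v) (0, 1) 0 = 0 ∧ fderiv ℝ N (u, v) (0, 1) 1 = 0 := by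
  have hS : Real.sinh ϑ ≠ 0 := by simpa using hϑ
  have hC : Real.cosh ϑ ^ 2 ≠ 0 := by positivity
  have hq : (u, v) ∈ I ×ˢ J := ⟨hu, hv⟩
  have hcos := h.cos_ne_zero hu hv (hF u hu v hv) (hG u hu v hv)
  have hunit := h.sq_add_sq _ hq
  have horth := h.normal_mul_fderiv_normal hq (1, 0)
  have horth' := h.normal_mul_fderiv_normal hq (0, 1)
  have hG0 : ∀ s ∈ I, fderiv ℝ F (s, v) (0, 1) 0 =
      Real.sin (η v - 2 * τ * Real.sinh ϑ ^ 2 * s) * N (s, v) 0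
        + Real.cos (η v - 2 * τ * Real.sinh ϑ ^ 2 * s) * N (s, v) 1 := by
    intro s hs
    rw [hG s hs v hv]
    simp only [PiLp.add_apply, PiLp.smul_apply, smul_eq_mul, vertical_sub_zero,
      cross_zero (h.contact_normal (s, v) ⟨hs, hv⟩)]
    field_simp
  have hG1 : ∀ s ∈ I, fderiv ℝ F (s, v) (0, 1) 1 =
      Real.sin (η v - 2 * τ * Real.sinh ϑ ^ 2 * s) * N (s, v) 1
        - Real.cos (η v - 2 * τ * Real.sinh ϑ ^ 2 * s) * N (s, v) 0 := by
    intro s hs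
    rw [hG s hs v hv]
    simp only [PiLp.add_apply, PiLp.smul_apply, smul_eq_mul, vertical_sub_one,
      cross_one (h.contact_normal (s, v) ⟨hs, hv⟩)]
    field_simp
    ring
  have hmix := fderiv_fderiv_comm h.isOpen h.smooth hq (0, 1) (1, 0)
  have hN := hasDerivAt_fst (h.differentiableAt_normal hq)
  have hψ : HasDerivAt (fun s => η v - 2 * τ * Real.sinh ϑ ^ 2 * s)
      (-(2 * τ * Real.sinh ϑ ^ 2)) u := by
    simpa using ((hasDerivAt_id u).const_mul (2 * τ * Real.sinh ϑ ^ 2)).const_sub (η v)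
  have hD := hasDerivAt_fst (differentiableAt_fderiv_apply h.isOpen h.smooth hq (0, 1))
  have hD0 := (hD.apply_R3 0).unique
    (((hψ.sin.mul (hN.apply_R3 0)).add (hψ.cos.mul (hN.apply_R3 1))).congr_of_eventuallyEq
      (Filter.eventually_of_mem (hI.mem_nhds hu) hG0))
  have hD1 := (hD.apply_R3 1).unique
    (((hψ.sin.mul (hN.apply_R3 1)).sub (hψ.cos.mul (hN.apply_R3 0))).congr_of_eventuallyEq
      (Filter.eventually_of_mem (hI.mem_nhds hu) hG1))
  have hN' := hasDerivAt_snd (h.differentiableAt_normal hq)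
  have hE := hasDerivAt_snd (differentiableAt_fderiv_apply h.isOpen h.smooth hq (1, 0))
  have hJ : ∀ᶠ s in nhds v, s ∈ J :=
    Filter.eventually_of_mem ((h.isOpen.preimage (Continuous.prodMk_right u)).mem_nhds hq)
      fun s hs => hs.2
  have hE0 := (hE.apply_R3 0).unique (((hN'.apply_R3 0).const_mul (Real.sinh ϑ)).neg.congr_of_eventuallyEq
    (hJ.mono fun s hs => by
      simp only [hF u hu s hs, vertical_sub_zero, Pi.neg_apply]))
  have hE1 := (hE.apply_R3 1).unique (((hN'.apply_R3 1).const_mul (Real.sinh ϑ)).neg.congr_of_eventuallyEq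
    (hJ.mono fun s hs => by
      simp only [hF u hu s hs, vertical_sub_one, Pi.neg_apply]))
  have hcod := h.codazzi hq (1, 0) (0, 1)
  rw [hG0 u hu, hG1 u hu, hF u hu v hv] at hcod
  simp only [vertical_sub_zero, vertical_sub_one] at hcod
  rw [hmix] at hD0 hD1
  rw [hE0] at hD0
  rw [hE1] at hD1
  clear hmix hN hψ hD hN' hE hJ hE0 hE1 hG0 hG1 hF hG
  generalize fderiv ℝ N (u, v) (1, 0) 0 = p0 at *
  generalize fderiv ℝ N (u, v) (1, 0) 1 = p1 at *
  generalize fderiv ℝ N (u, v) (0, 1) 0 = r0 at *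
  generalize fderiv ℝ N (u, v) (0, 1) 1 = r1 at *
  generalize N (u, v) 0 = n0 at *
  generalize N (u, v) 1 = n1 at *
  generalize η v - 2 * τ * Real.sinh ϑ ^ 2 * u = ψ at *
  generalize Real.sinh ϑ = S at *
  generalize Real.cosh ϑ ^ 2 = D at *
  have hsc := Real.sin_sq_add_cos_sq ψ
  generalize Real.sin ψ = s at *
  generalize Real.cos ψ = c at *
  -- The structure equation on (∂_u, ∂_v), divided by the nonzero cosine: the sine part and the
  -- v-derivatives of N drop out because N has constant horizontal length.
  have hrot : p1 * n0 - p0 * n1 = 2 * τ * S ^ 2 * D := by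
    apply mul_left_cancel₀ hcos
    linear_combination s * horth + S * horth' + 2 * τ * S ^ 2 * c * hunit - hcod
  have hp0 : p0 = -(2 * τ * S ^ 2) * n1 := by
    apply mul_left_cancel₀ hC
    linear_combination -p0 * hunit + n0 * horth - n1 * hrot
  have hp1 : p1 = 2 * τ * S ^ 2 * n0 := by
    apply mul_left_cancel₀ hC
    linear_combination -p1 * hunit + n1 * horth + n0 * hrot
  -- The phase of ∂_v relative to N decreases at the rate at which N turns, so the horizontal part
  -- of ∂_v is constant in u. By symmetry the v-derivative of the horizontal part of T, which is
  -- -sinh ϑ times that of N, vanishes.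
  refine ⟨⟨hp0, hp1⟩, ?_, ?_⟩
  · apply mul_left_cancel₀ hS
    subst hp0 hp1
    linear_combination -hD0
  · apply mul_left_cancel₀ hS
    subst hp0 hp1
    linear_combination -hD1

end IsHelixPatch

theorem exists_polar {a b C : ℝ} (hC : 0 < C) (h : a ^ 2 + b ^ 2 = C ^ 2) :
    ∃ c, a = C * Real.cos c ∧ b = C * Real.sin c := by
  have hn : ‖(⟨a, b⟩ : ℂ)‖ = C := by
    rw [← sq_eq_sq₀ (norm_nonneg _) hC.le, Complex.sq_norm, Complex.normSq_mk, ← h]; ring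
  refine ⟨Complex.arg ⟨a, b⟩, ?_, ?_⟩
  · have := Complex.norm_mul_cos_arg ⟨a, b⟩
    rw [hn] at this; exact this.symm
  · have := Complex.norm_mul_sin_arg ⟨a, b⟩
    rw [hn] at this; exact this.symm

theorem coth_mul_sinh {x : ℝ} (hx : x ≠ 0) : coth x * Real.sinh x = Real.cosh x :=
  div_mul_cancel₀ _ (by simpa using hx)

/-! ### Integration of the normal and of the position vector. -/

namespace IsHelixPatch

variable {τ ϑ : ℝ} {F N : ℝ × ℝ → R3} {I J : Set ℝ} {η : ℝ → ℝ}

/-- A normal that rotates with constant speed along the first coordinate and is constant along the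
second one is determined by a phase. -/
theorem exists_phase (h : IsHelixPatch τ ϑ F N (I ×ˢ J)) (hI : IsOpen I) (hJ : IsOpen J)
    (hI' : I.OrdConnected) (hJ' : J.OrdConnected) {k u₀ v₀ : ℝ} (hu₀ : u₀ ∈ I) (hv₀ : v₀ ∈ J)
    (hN : ∀ u ∈ I, ∀ v ∈ J, (fderiv ℝ N (u, v) (1, 0) 0 = -k * N (u, v) 1 ∧
      fderiv ℝ N (u, v) (1, 0) 1 = k * N (u, v) 0) ∧
      fderiv ℝ N (u, v) (0, 1) 0 = 0 ∧ fderiv ℝ N (u, v) (0, 1) 1 = 0) :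
    ∃ c, ∀ u ∈ I, ∀ v ∈ J, N (u, v) 0 = Real.cosh ϑ * Real.cos (k * u + c) ∧
      N (u, v) 1 = Real.cosh ϑ * Real.sin (k * u + c) := by
  have hk : ∀ u : ℝ, HasDerivAt (fun s => k * s) k u := fun u => by
    simpa using (hasDerivAt_id u).const_mul k
  have hv : ∀ i, i = 0 ∨ i = 1 → ∀ u ∈ I, ∀ v ∈ J, N (u, v) i = N (u, v₀) i := by
    intro i hi u hu v hv
    refine eq_of_hasDerivAt_zero hJ hJ' (f := fun v => N (u, v) i) (fun v hv => ?_) hv hv₀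
    have h1 := (hasDerivAt_snd (h.differentiableAt_normal ⟨hu, hv⟩)).apply_R3 i
    obtain ⟨-, h2, h3⟩ := hN u hu v hv
    rcases hi with rfl | rfl
    · rwa [h2] at h1
    · rwa [h3] at h1
  -- The two components of the normal turned back through the angle ku are constant; their polar
  -- angle is the phase c.
  have hP : ∀ u ∈ I, N (u, v₀) 0 * Real.cos (k * u) + N (u, v₀) 1 * Real.sin (k * u)
      = N (u₀, v₀) 0 * Real.cos (k * u₀) + N (u₀, v₀) 1 * Real.sin (k * u₀) := by
    intro u hu
    refine eq_of_hasDerivAt_zero hI hI' (f := fun u => N (u, v₀) 0 * Real.cos (k * u)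
      + N (u, v₀) 1 * Real.sin (k * u)) (fun u hu => ?_) hu hu₀
    have h1 := hasDerivAt_fst (h.differentiableAt_normal ⟨hu, hv₀⟩)
    obtain ⟨⟨h2, h3⟩, -⟩ := hN u hu v₀ hv₀
    refine (((h1.apply_R3 0).mul (hk u).cos).add ((h1.apply_R3 1).mul (hk u).sin)).congr_deriv ?_
    rw [h2, h3]; ring
  have hQ : ∀ u ∈ I, N (u, v₀) 1 * Real.cos (k * u) - N (u, v₀) 0 * Real.sin (k * u)
      = N (u₀, v₀) 1 * Real.cos (k * u₀) - N (u₀, v₀) 0 * Real.sin (k * u₀) := by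
    intro u hu
    refine eq_of_hasDerivAt_zero hI hI' (f := fun u => N (u, v₀) 1 * Real.cos (k * u)
      - N (u, v₀) 0 * Real.sin (k * u)) (fun u hu => ?_) hu hu₀
    have h1 := hasDerivAt_fst (h.differentiableAt_normal ⟨hu, hv₀⟩)
    obtain ⟨⟨h2, h3⟩, -⟩ := hN u hu v₀ hv₀
    refine (((h1.apply_R3 1).mul (hk u).cos).sub ((h1.apply_R3 0).mul (hk u).sin)).congr_deriv ?_
    rw [h2, h3]; ring
  obtain ⟨c, hc0, hc1⟩ := exists_polar (Real.cosh_pos ϑ)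
    (a := N (u₀, v₀) 0 * Real.cos (k * u₀) + N (u₀, v₀) 1 * Real.sin (k * u₀))
    (b := N (u₀, v₀) 1 * Real.cos (k * u₀) - N (u₀, v₀) 0 * Real.sin (k * u₀)) (by
      rw [← h.sq_add_sq _ (show (u₀, v₀) ∈ I ×ˢ J from ⟨hu₀, hv₀⟩)]
      linear_combination (N (u₀, v₀) 0 ^ 2 + N (u₀, v₀) 1 ^ 2) * Real.sin_sq_add_cos_sq (k * u₀))
  refine ⟨c, fun u hu v hvJ => ?_⟩
  rw [hv 0 (Or.inl rfl) u hu v hvJ, hv 1 (Or.inr rfl) u hu v hvJ, Real.cos_add, Real.sin_add]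
  have h1 := hP u hu
  have h2 := hQ u hu
  have h3 := Real.sin_sq_add_cos_sq (k * u)
  constructor
  · linear_combination Real.cos (k * u) * (h1 + hc0) - Real.sin (k * u) * (h2 + hc1)
      - N (u, v₀) 0 * h3
  · linear_combination Real.sin (k * u) * (h1 + hc0) + Real.cos (k * u) * (h2 + hc1)
      - N (u, v₀) 1 * h3

/-- Integration of the vertical tangent field along the first coordinate. -/
theorem integrate_fst (h : IsHelixPatch τ ϑ F N (I ×ˢ J)) (hI : IsOpen I) (hI' : I.OrdConnected)
    (hτ : τ ≠ 0) (hϑ : ϑ ≠ 0) {c : ℝ}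
    (hF : ∀ u ∈ I, ∀ v ∈ J, fderiv ℝ F (u, v) (1, 0) = E3 - Real.sinh ϑ • N (u, v))
    (hN : ∀ u ∈ I, ∀ v ∈ J,
      N (u, v) 0 = Real.cosh ϑ * Real.cos (2 * τ * Real.sinh ϑ ^ 2 * u + c) ∧
      N (u, v) 1 = Real.cosh ϑ * Real.sin (2 * τ * Real.sinh ϑ ^ 2 * u + c))
    {u u₀ v : ℝ} (hu : u ∈ I) (hu₀ : u₀ ∈ I) (hv : v ∈ J) :
    F (u, v) 0 + coth ϑ / (2 * τ) * Real.sin (2 * τ * Real.sinh ϑ ^ 2 * u + c)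
      = F (u₀, v) 0 + coth ϑ / (2 * τ) * Real.sin (2 * τ * Real.sinh ϑ ^ 2 * u₀ + c) ∧
    F (u, v) 1 - coth ϑ / (2 * τ) * Real.cos (2 * τ * Real.sinh ϑ ^ 2 * u + c)
      = F (u₀, v) 1 - coth ϑ / (2 * τ) * Real.cos (2 * τ * Real.sinh ϑ ^ 2 * u₀ + c) := by
  have hk : ∀ u : ℝ, HasDerivAt (fun s => 2 * τ * Real.sinh ϑ ^ 2 * s + c)
      (2 * τ * Real.sinh ϑ ^ 2) u := fun u => by
    simpa using ((hasDerivAt_id u).const_mul (2 * τ * Real.sinh ϑ ^ 2)).add_const c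
  have hK := coth_mul_sinh hϑ
  constructor
  · refine eq_of_hasDerivAt_zero hI hI' (f := fun u => F (u, v) 0 + coth ϑ / (2 * τ) *
      Real.sin (2 * τ * Real.sinh ϑ ^ 2 * u + c)) (fun u hu => ?_) hu hu₀
    have h1 := (hasDerivAt_fst (h.differentiableAt (q := (u, v)) ⟨hu, hv⟩)).apply_R3 0
    refine (h1.add ((hk u).sin.const_mul _)).congr_deriv ?_
    rw [hF u hu v hv, vertical_sub_zero, (hN u hu v hv).1, ← hK]
    field_simp
    ring
  · refine eq_of_hasDerivAt_zero hI hI' (f := fun u => F (u, v) 1 - coth ϑ / (2 * τ) *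
      Real.cos (2 * τ * Real.sinh ϑ ^ 2 * u + c)) (fun u hu => ?_) hu hu₀
    have h1 := (hasDerivAt_fst (h.differentiableAt (q := (u, v)) ⟨hu, hv⟩)).apply_R3 1
    refine (h1.sub ((hk u).cos.const_mul _)).congr_deriv ?_
    rw [hF u hu v hv, vertical_sub_one, (hN u hu v hv).2, ← hK]
    field_simp
    ring

/-- With N an explicit function of u alone, ∂_u F = T is an ordinary differential equation in u for
each v. Its constants of integration are the functions f₁, f₂, f₃, and ∂_v F on the slice u = u₀
determines their derivatives. -/
theorem exists_parametrization (h : IsHelixPatch τ ϑ F N (I ×ˢ J)) (hI : IsOpen I)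
    (hJ : IsOpen J) (hI' : I.OrdConnected) (hJ' : J.OrdConnected) (hτ : τ ≠ 0) (hϑ : ϑ ≠ 0)
    (hF : ∀ u ∈ I, ∀ v ∈ J, fderiv ℝ F (u, v) (1, 0) = E3 - Real.sinh ϑ • N (u, v))
    (hG : ∀ u ∈ I, ∀ v ∈ J, fderiv ℝ F (u, v) (0, 1) =
      (-(Real.sin (η v - 2 * τ * Real.sinh ϑ ^ 2 * u) / Real.sinh ϑ)) •
          (E3 - Real.sinh ϑ • N (u, v))
        + Real.cos (η v - 2 * τ * Real.sinh ϑ ^ 2 * u) •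
          cross τ (F (u, v)) (N (u, v)) (E3 - Real.sinh ϑ • N (u, v)))
    {u₀ v₀ : ℝ} (hu₀ : u₀ ∈ I) (hv₀ : v₀ ∈ J) :
    ∃ (c : ℝ) (f₁ f₂ f₃ : ℝ → ℝ),
      ContDiffOn ℝ ∞ f₁ J ∧ ContDiffOn ℝ ∞ f₂ J ∧ ContDiffOn ℝ ∞ f₃ J ∧
      (∀ v ∈ J, deriv f₁ v ^ 2 + deriv f₂ v ^ 2 = Real.cosh ϑ ^ 2) ∧
      (∀ v ∈ J, deriv f₃ v = τ * (f₂ v * deriv f₁ v - f₁ v * deriv f₂ v)) ∧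
      ∀ u ∈ I, ∀ v ∈ J, F (u, v) =
        !₂[-(coth ϑ / (2 * τ)) * Real.sin (2 * τ * Real.sinh ϑ ^ 2 * u + c) + f₁ v,
          coth ϑ / (2 * τ) * Real.cos (2 * τ * Real.sinh ϑ ^ 2 * u + c) + f₂ v,
          Real.cosh ϑ ^ 2 / 2 * u
            - coth ϑ / 2 * (f₁ v * Real.cos (2 * τ * Real.sinh ϑ ^ 2 * u + c)
              + f₂ v * Real.sin (2 * τ * Real.sinh ϑ ^ 2 * u + c)) + f₃ v] := by
  have hS : Real.sinh ϑ ≠ 0 := by simpa using hϑ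
  have hK := coth_mul_sinh hϑ
  obtain ⟨c, hc⟩ := h.exists_phase hI hJ hI' hJ' hu₀ hv₀
    (fun u hu v hv => h.fderiv_normal hI hϑ hF hG hu hv)
  have hk : ∀ u : ℝ, HasDerivAt (fun s => 2 * τ * Real.sinh ϑ ^ 2 * s + c)
      (2 * τ * Real.sinh ϑ ^ 2) u := fun u => by
    simpa using ((hasDerivAt_id u).const_mul (2 * τ * Real.sinh ϑ ^ 2)).add_const c
  set φ : ℝ → ℝ := fun u => 2 * τ * Real.sinh ϑ ^ 2 * u + c with hφ
  -- The three functions are obtained by solving the claimed formula for them at u = u₀.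
  set f₁ : ℝ → ℝ := fun v => F (u₀, v) 0 + coth ϑ / (2 * τ) * Real.sin (φ u₀) with hf₁
  set f₂ : ℝ → ℝ := fun v => F (u₀, v) 1 - coth ϑ / (2 * τ) * Real.cos (φ u₀) with hf₂
  set f₃ : ℝ → ℝ := fun v => F (u₀, v) 2 - Real.cosh ϑ ^ 2 / 2 * u₀
    + coth ϑ / 2 * (f₁ v * Real.cos (φ u₀) + f₂ v * Real.sin (φ u₀)) with hf₃
  have hsm : ∀ i, ContDiffOn ℝ ∞ (fun v => F (u₀, v) i) J :=
    contDiffOn_R3_iff.1 (contDiffOn_slice h.smooth hu₀)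
  have hs₁ : ContDiffOn ℝ ∞ f₁ J := (hsm 0).add contDiffOn_const
  have hs₂ : ContDiffOn ℝ ∞ f₂ J := (hsm 1).sub contDiffOn_const
  have hs₃ : ContDiffOn ℝ ∞ f₃ J := ((hsm 2).sub contDiffOn_const).add
    (contDiffOn_const.mul ((hs₁.mul contDiffOn_const).add (hs₂.mul contDiffOn_const)))
  have hx : ∀ u ∈ I, ∀ v ∈ J, F (u, v) 0 = f₁ v - coth ϑ / (2 * τ) * Real.sin (φ u) :=
    fun u hu v hv => by
      linarith [(h.integrate_fst hI hI' hτ hϑ hF hc hu hu₀ hv).1]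
  have hy : ∀ u ∈ I, ∀ v ∈ J, F (u, v) 1 = f₂ v + coth ϑ / (2 * τ) * Real.cos (φ u) :=
    fun u hu v hv => by
      linarith [(h.integrate_fst hI hI' hτ hϑ hF hc hu hu₀ hv).2]
  have hz : ∀ u ∈ I, ∀ v ∈ J, F (u, v) 2 - Real.cosh ϑ ^ 2 / 2 * u
      + coth ϑ / 2 * (f₁ v * Real.cos (φ u) + f₂ v * Real.sin (φ u)) = f₃ v := by
    intro u hu v hv
    refine eq_of_hasDerivAt_zero hI hI' (f := fun u => F (u, v) 2 - Real.cosh ϑ ^ 2 / 2 * u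
      + coth ϑ / 2 * (f₁ v * Real.cos (φ u) + f₂ v * Real.sin (φ u))) (fun u hu => ?_) hu hu₀
    have h1 := (hasDerivAt_fst (h.differentiableAt (q := (u, v)) ⟨hu, hv⟩)).apply_R3 2
    refine ((h1.sub ((hasDerivAt_id u).const_mul _)).add (((hk u).cos.const_mul _).add
      ((hk u).sin.const_mul _) |>.const_mul _)).congr_deriv ?_
    -- The equation ω(T) = cosh²ϑ gives ∂_u z once x and y are known.
    have h2 := contact_vertical_sub (h.contact_normal (u, v) ⟨hu, hv⟩)
    rw [hF u hu v hv]
    rw [contact, vertical_sub_zero, vertical_sub_one, hx u hu v hv, hy u hu v hv,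
      (hc u hu v hv).1, (hc u hu v hv).2] at h2
    have h3 := Real.sin_sq_add_cos_sq (φ u)
    change _ - τ * (_ * -(_ * (_ * Real.cos (φ u))) - _ * -(_ * (_ * Real.sin (φ u)))) = _ at h2
    rw [← hK] at h2 ⊢
    have h4 : τ * (coth ϑ / (2 * τ)) = coth ϑ / 2 := by field_simp
    linear_combination h2 - (coth ϑ * Real.sinh ϑ ^ 2 * coth ϑ / 2) * h3
      - (coth ϑ * Real.sinh ϑ ^ 2) * (Real.sin (φ u) ^ 2 + Real.cos (φ u) ^ 2) * h4
  have hd : ∀ v ∈ J, HasDerivAt f₁ (Real.cosh ϑ * Real.sin (η v + c)) v ∧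
      HasDerivAt f₂ (-(Real.cosh ϑ * Real.cos (η v + c))) v ∧
      fderiv ℝ F (u₀, v) (0, 1) 2 - τ * (F (u₀, v) 1 * (Real.cosh ϑ * Real.sin (η v + c))
        - F (u₀, v) 0 * -(Real.cosh ϑ * Real.cos (η v + c)))
        = -(Real.sin (η v - 2 * τ * Real.sinh ϑ ^ 2 * u₀) / Real.sinh ϑ) * Real.cosh ϑ ^ 2 := by
    intro v hv
    have hcn := h.contact_normal (u₀, v) ⟨hu₀, hv⟩
    have hD := hasDerivAt_snd (h.differentiableAt (q := (u₀, v)) ⟨hu₀, hv⟩)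
    -- The u-dependence of the phase of ∂_v cancels that of φ, so the horizontal velocity is cosh ϑ
    -- (sin(η + c), -cos(η + c)).
    have hψ : η v + c = (η v - 2 * τ * Real.sinh ϑ ^ 2 * u₀) + φ u₀ := by rw [hφ]; ring
    have e0 : fderiv ℝ F (u₀, v) (0, 1) 0 = Real.cosh ϑ * Real.sin (η v + c) := by
      rw [hG u₀ hu₀ v hv, hψ, Real.sin_add]
      simp only [PiLp.add_apply, PiLp.smul_apply, smul_eq_mul, vertical_sub_zero, cross_zero hcn,
        (hc u₀ hu₀ v hv).1, (hc u₀ hu₀ v hv).2]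
      field_simp
      ring
    have e1 : fderiv ℝ F (u₀, v) (0, 1) 1 = -(Real.cosh ϑ * Real.cos (η v + c)) := by
      rw [hG u₀ hu₀ v hv, hψ, Real.cos_add]
      simp only [PiLp.add_apply, PiLp.smul_apply, smul_eq_mul, vertical_sub_one, cross_one hcn,
        (hc u₀ hu₀ v hv).1, (hc u₀ hu₀ v hv).2]
      field_simp
      ring
    refine ⟨?_, ?_, ?_⟩
    · rw [← e0]; exact (hD.apply_R3 0).add_const _
    · rw [← e1]; exact (hD.apply_R3 1).sub_const _
    · rw [← e0, ← e1]
      change contact τ (F (u₀, v)) _ = _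
      rw [hG u₀ hu₀ v hv, contact_add, contact_smul, contact_smul, contact_vertical_sub hcn,
        contact_cross]
      ring
  refine ⟨c, f₁, f₂, f₃, hs₁, hs₂, hs₃, fun v hv => ?_, fun v hv => ?_, fun u hu v hv => ?_⟩
  · rw [(hd v hv).1.deriv, (hd v hv).2.1.deriv]
    linear_combination Real.cosh ϑ ^ 2 * Real.sin_sq_add_cos_sq (η v + c)
  · obtain ⟨h1, h2, h3⟩ := hd v hv
    have hD := (hasDerivAt_snd (h.differentiableAt (q := (u₀, v)) ⟨hu₀, hv⟩)).apply_R3 2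
    have h4 := (hD.sub_const (Real.cosh ϑ ^ 2 / 2 * u₀)).add
      (((h1.mul_const (Real.cos (φ u₀))).add (h2.mul_const (Real.sin (φ u₀)))).const_mul
        (coth ϑ / 2))
    rw [h1.deriv, h2.deriv]
    refine h4.deriv.trans ?_
    have hψ : η v - 2 * τ * Real.sinh ϑ ^ 2 * u₀ = (η v + c) - φ u₀ := by rw [hφ]; ring
    rw [hψ, Real.sin_sub, hx u₀ hu₀ v hv, hy u₀ hu₀ v hv] at h3
    have h5 : Real.cosh ϑ / Real.sinh ϑ = coth ϑ := rfl
    have h4 : τ * (coth ϑ / (2 * τ)) = coth ϑ / 2 := by field_simp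
    have h6 : (fderiv ℝ F (u₀, v) (0, 1)) 2 = _ := sub_eq_iff_eq_add.1 h3
    rw [h6]
    have h7 : ∀ x : ℝ, -(x / Real.sinh ϑ) * Real.cosh ϑ ^ 2 = -(x * coth ϑ * Real.cosh ϑ) := by
      intro x; rw [← h5]; ring
    rw [h7]
    linear_combination (Real.cosh ϑ * (Real.cos (φ u₀) * Real.sin (η v + c)
      - Real.sin (φ u₀) * Real.cos (η v + c))) * h4
  · ext i
    fin_cases i
    · simp [hx u hu v hv, hφ]; ring
    · simp [hy u hu v hv, hφ]; ring
    · simp only [← hz u hu v hv]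
      simp [hφ]

end IsHelixPatch

/-! ### Smooth angles, local inverses, boxes, primitives. -/

section Calculus

variable {E : Type*} [NormedAddCommGroup E] [NormedSpace ℝ E]

/-- Near every point, a smooth map into a circle of radius `C` has a smooth angle. -/
theorem exists_smooth_angle {U : Set E} (hU : IsOpen U) {p q : E → ℝ} {C : ℝ} (hC : 0 < C)
    (hp : ContDiffOn ℝ ∞ p U) (hq : ContDiffOn ℝ ∞ q U) (h : ∀ x ∈ U, p x ^ 2 + q x ^ 2 = C ^ 2)
    {x₀ : E} (hx₀ : x₀ ∈ U) :
    ∃ (V : Set E) (θ : E → ℝ), IsOpen V ∧ V ⊆ U ∧ x₀ ∈ V ∧ ContDiffOn ℝ ∞ θ V ∧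
      ∀ x ∈ V, p x = C * Real.cos (θ x) ∧ q x = C * Real.sin (θ x) := by
  obtain ⟨α, h0, h1⟩ := exists_polar hC (h x₀ hx₀)
  -- Rotating and scaling takes the value at x₀ to (1, 0); on the half-plane P > 0 the arcsine of Q
  -- is a smooth angle.
  set P : E → ℝ := fun x => (Real.cos α * p x + Real.sin α * q x) / C with hP
  set Q : E → ℝ := fun x => (Real.cos α * q x - Real.sin α * p x) / C with hQ
  have hsα := Real.sin_sq_add_cos_sq α
  have hPs : ContDiffOn ℝ ∞ P U :=
    ((contDiffOn_const.mul hp).add (contDiffOn_const.mul hq)).div_const _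
  have hQs : ContDiffOn ℝ ∞ Q U :=
    ((contDiffOn_const.mul hq).sub (contDiffOn_const.mul hp)).div_const _
  have hPQ : ∀ x ∈ U, P x ^ 2 + Q x ^ 2 = 1 := by
    intro x hx
    simp only [hP, hQ]
    field_simp
    linear_combination (p x ^ 2 + q x ^ 2) * hsα + h x hx
  have hV : IsOpen (U ∩ P ⁻¹' Set.Ioi 0) := hPs.continuousOn.isOpen_inter_preimage hU isOpen_Ioi
  have hQlt : ∀ x ∈ U ∩ P ⁻¹' Set.Ioi 0, -1 < Q x ∧ Q x < 1 := by
    rintro x ⟨hx, hx'⟩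
    have h2 := hPQ x hx
    have h3 : 0 < P x := hx'
    rw [← abs_lt, ← sq_lt_one_iff_abs_lt_one]
    nlinarith
  refine ⟨U ∩ P ⁻¹' Set.Ioi 0, fun x => α + Real.arcsin (Q x), hV, Set.inter_subset_left,
    ⟨hx₀, ?_⟩, ?_, ?_⟩
  · have : P x₀ = 1 := by
      simp only [hP, h0, h1]
      field_simp
      linear_combination hsα
    simp [this]
  · intro x hx
    have h2 : ContDiffAt ℝ ∞ Real.arcsin (Q x) :=
      Real.contDiffAt_arcsin (hQlt x hx).1.ne' (hQlt x hx).2.ne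
    exact contDiffWithinAt_const.add
      (h2.comp_contDiffWithinAt x ((hQs x hx.1).mono Set.inter_subset_left))
  · intro x hx
    have h2 := hPQ x hx.1
    have h3 : 0 < P x := hx.2
    have hsin : Real.sin (Real.arcsin (Q x)) = Q x :=
      Real.sin_arcsin (hQlt x hx).1.le (hQlt x hx).2.le
    have hcos : Real.cos (Real.arcsin (Q x)) = P x := by
      rw [Real.cos_arcsin, ← h2, add_sub_cancel_right, Real.sqrt_sq h3.le]
    simp only [Real.cos_add, Real.sin_add, hsin, hcos]
    simp only [hP, hQ]
    constructor
    · field_simp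
      linear_combination -p x * hsα
    · field_simp
      linear_combination -q x * hsα

variable {G : Type*} [NormedAddCommGroup G] [NormedSpace ℝ G]

/-- The inverse function theorem, as a smooth partial diffeomorphism, with the chain rule for
functions read in the inverse. -/
theorem exists_local_inverse [FiniteDimensional ℝ E] [FiniteDimensional ℝ G]
    (hdim : Module.finrank ℝ E = Module.finrank ℝ G) {H : E → G} {U : Set E} (hU : IsOpen U)
    (hH : ContDiffOn ℝ ∞ H U) {x : E} (hx : x ∈ U) (hinj : Function.Injective (fderiv ℝ H x)) :
    ∃ Y : PartialDiffeomorph 𝓘(ℝ, G) 𝓘(ℝ, E) G E ∞, x ∈ Y.target ∧ Y.target ⊆ U ∧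
      (∀ w ∈ Y.source, H (Y w) = w) ∧
      ∀ F : E → R3, ∀ w ∈ Y.source, DifferentiableAt ℝ F (Y w) → ∀ a,
        fderiv ℝ (fun w => F (Y w)) w (fderiv ℝ H (Y w) a) = fderiv ℝ F (Y w) a := by
  have : CompleteSpace E := FiniteDimensional.complete ℝ E
  have hAt : ∀ y ∈ U, ContDiffAt ℝ ∞ H y := fun y hy => hH.contDiffAt (hU.mem_nhds hy)
  have hd : ∀ y ∈ U, HasFDerivAt H (fderiv ℝ H y) y := fun y hy =>
    ((hAt y hy).differentiableAt (by simp)).hasFDerivAt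
  let L : E ≃L[ℝ] G :=
    (LinearMap.linearEquivOfInjective (fderiv ℝ H x).toLinearMap hinj hdim).toContinuousLinearEquiv
  have hL : (L : E →L[ℝ] G) = fderiv ℝ H x := by ext a; rfl
  have hx' : HasFDerivAt H (L : E →L[ℝ] G) x := hL ▸ hd x hx
  set e := (hAt x hx).toOpenPartialHomeomorph H hx' (by simp) with he
  -- Restricting to the open set where the differential is invertible makes the inverse smooth at
  -- every point of the target, not only at H x.
  set V : Set E := U ∩ fderiv ℝ H ⁻¹' Set.range ((↑) : (E ≃L[ℝ] G) → E →L[ℝ] G) with hV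
  have hVo : IsOpen V :=
    ((contDiffOn_infty_iff_fderiv_of_isOpen hU).1 hH).2.continuousOn.isOpen_inter_preimage hU
      ContinuousLinearEquiv.isOpen
  set e' := e.restrOpen V hVo with he'
  have hsrc : e'.source = e.source ∩ V := e.restrOpen_source V hVo
  have hcoe : ∀ y, e' y = H y := fun y => rfl
  have hsymm : ContDiffOn ℝ ∞ e'.symm e'.target := by
    intro w hw
    have h1 := e'.map_target hw
    rw [hsrc] at h1
    obtain ⟨-, h2, ⟨K, hK⟩⟩ := h1
    exact (e'.contDiffAt_symm hw (f₀' := K) (by rw [hK]; exact hd _ h2)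
      (hAt _ h2)).contDiffWithinAt
  have htU : e'.source ⊆ U := by rw [hsrc]; exact fun y hy => hy.2.1
  refine ⟨{ toPartialEquiv := e'.symm.toPartialEquiv
            open_source := e'.open_target
            open_target := e'.open_source
            contMDiffOn_toFun := contMDiffOn_iff_contDiffOn.2 hsymm
            contMDiffOn_invFun := contMDiffOn_iff_contDiffOn.2 (hH.mono htU) }, ?_, htU, ?_, ?_⟩
  · change x ∈ e'.source
    rw [hsrc]
    exact ⟨(hAt x hx).mem_toOpenPartialHomeomorph_source hx' (by simp), hx, L, hL⟩
  · exact fun w hw => e'.right_inv hw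
  · intro F w hw hF a
    change fderiv ℝ (fun w => F (e'.symm w)) w (fderiv ℝ H (e'.symm w) a)
      = fderiv ℝ F (e'.symm w) a
    set y := e'.symm w with hy
    have hyS : y ∈ e'.source := e'.map_target hw
    have hHy : H y = w := e'.right_inv hw
    have hdw : DifferentiableAt ℝ (fun w => F (e'.symm w)) (H y) := by
      rw [hHy]
      exact hF.comp w ((hsymm.contDiffAt (e'.open_target.mem_nhds hw)).differentiableAt (by simp))
    have h1 := hdw.hasFDerivAt.comp y (hd y (htU hyS))
    have h2 : F =ᶠ[nhds y] (fun w => F (e'.symm w)) ∘ H :=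
      Filter.eventually_of_mem (e'.open_source.mem_nhds hyS) fun z hz =>
        congrArg F (e'.left_inv hz).symm
    rw [(h1.congr_of_eventuallyEq h2).fderiv, hHy]
    rfl

theorem exists_box {s : Set (ℝ × ℝ)} (hs : IsOpen s) {w : ℝ × ℝ} (hw : w ∈ s) :
    ∃ I J : Set ℝ, IsOpen I ∧ IsOpen J ∧ I.OrdConnected ∧ J.OrdConnected ∧ w ∈ I ×ˢ J ∧
      I ×ˢ J ⊆ s := by
  obtain ⟨r, hr, hrs⟩ := Metric.isOpen_iff.1 hs w hw
  refine ⟨Metric.ball w.1 r, Metric.ball w.2 r, Metric.isOpen_ball, Metric.isOpen_ball,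
    (convex_ball _ _).ordConnected, (convex_ball _ _).ordConnected,
    ⟨Metric.mem_ball_self hr, Metric.mem_ball_self hr⟩, ?_⟩
  rwa [ball_prod_same]

theorem exists_box_line {J : Set ℝ} (hJ : IsOpen J) {v : ℝ} (hv : v ∈ J) :
    ∃ K ⊆ J, IsOpen K ∧ K.OrdConnected ∧ v ∈ K := by
  obtain ⟨r, hr, hrs⟩ := Metric.isOpen_iff.1 hJ v hv
  exact ⟨_, hrs, Metric.isOpen_ball, (convex_ball _ _).ordConnected, Metric.mem_ball_self hr⟩

/-- A primitive of a smooth function on an open interval. -/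
theorem exists_primitive {J : Set ℝ} (hJ : IsOpen J) (hJ' : J.OrdConnected) {ρ : ℝ → ℝ}
    (hρ : ContDiffOn ℝ ∞ ρ J) {v₀ : ℝ} (hv₀ : v₀ ∈ J) :
    ∃ h : ℝ → ℝ, ContDiffOn ℝ ∞ h J ∧ ∀ v ∈ J, HasDerivAt h (ρ v) v := by
  have hd : ∀ v ∈ J, HasDerivAt (fun v => ∫ t in v₀..v, ρ t) (ρ v) v := by
    intro v hv
    exact intervalIntegral.integral_hasDerivAt_right
      ((hρ.continuousOn.mono (hJ'.uIcc_subset hv₀ hv)).intervalIntegrable)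
      (hρ.continuousOn.stronglyMeasurableAtFilter hJ v hv)
      (hρ.continuousOn.continuousAt (hJ.mem_nhds hv))
  refine ⟨_, (contDiffOn_infty_iff_deriv_of_isOpen hJ).2
    ⟨fun v hv => (hd v hv).differentiableAt.differentiableWithinAt, ?_⟩, hd⟩
  exact hρ.congr fun v hv => (hd v hv).deriv

/-- Restriction of a partial diffeomorphism to a smaller open source. -/
theorem exists_restrict {M : Type*} [TopologicalSpace M] [ChartedSpace R2 M]
    (X : PartialDiffeomorph 𝓘(ℝ, E) 𝓘(ℝ, R2) E M ∞) {s : Set E} (hs : IsOpen s)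
    (hsX : s ⊆ X.source) :
    ∃ X' : PartialDiffeomorph 𝓘(ℝ, E) 𝓘(ℝ, R2) E M ∞, X'.source = s ∧ ∀ w, X' w = X w := by
  set e := X.toOpenPartialHomeomorph.restrOpen s hs with he
  have hsrc : e.source = s := by
    rw [he, OpenPartialHomeomorph.restrOpen_source]
    exact Set.inter_eq_right.2 hsX
  refine ⟨{ toPartialEquiv := e.toPartialEquiv
            open_source := e.open_source
            open_target := e.open_target
            contMDiffOn_toFun := X.contMDiffOn_toFun.mono (by rw [hsrc]; exact hsX)
            contMDiffOn_invFun := X.contMDiffOn_invFun.mono ?_ }, hsrc, fun _ => rfl⟩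
  intro y hy
  have h1 := e.map_target hy
  rw [hsrc] at h1
  have h2 := X.map_source (hsX h1)
  have h3 : X (e.symm y) = y := e.right_inv hy
  rwa [h3] at h2

end Calculus

/-! ### Coordinates in which the first coordinate vector is T. -/

/-- A helix patch in the plane whose first coordinate vector is the vertical tangent field, with a
normal that rotates with constant speed. -/
structure IsVerticalPatch (τ ϑ : ℝ) (F N : ℝ × ℝ → R3) (U : Set (ℝ × ℝ)) : Prop extends
    IsHelixPatch τ ϑ F N U where
  fst_eq : ∀ w ∈ U, fderiv ℝ F w (1, 0) = E3 - Real.sinh ϑ • N w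
  normal_zero : ∀ w ∈ U, N w 0 = Real.cosh ϑ * Real.cos (2 * τ * Real.sinh ϑ ^ 2 * w.1)
  normal_one : ∀ w ∈ U, N w 1 = Real.cosh ϑ * Real.sin (2 * τ * Real.sinh ϑ ^ 2 * w.1)

namespace IsHelixPatch

variable {τ ϑ : ℝ}

/-- An angle of the normal grows with constant speed along the vertical tangent field. -/
theorem fderiv_angle {E : Type*} [NormedAddCommGroup E] [NormedSpace ℝ E]
    {F N : E → R3} {U V : Set E} {θ : E → ℝ} (h : IsHelixPatch τ ϑ F N U)
    (hE : Module.finrank ℝ E = 2) (hϑ : ϑ ≠ 0) (hV : IsOpen V) (hVU : V ⊆ U)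
    (hθ : ContDiffOn ℝ ∞ θ V)
    (hN : ∀ x ∈ V, N x 0 = Real.cosh ϑ * Real.cos (θ x) ∧ N x 1 = Real.cosh ϑ * Real.sin (θ x))
    {q a : E} (hq : q ∈ V) (ha : fderiv ℝ F q a = E3 - Real.sinh ϑ • N q) :
    fderiv ℝ θ q a = 2 * τ * Real.sinh ϑ ^ 2 := by
  have hC : Real.cosh ϑ ≠ 0 := (Real.cosh_pos ϑ).ne'
  have hcn := h.contact_normal q (hVU hq)
  have hdN : ∀ b, fderiv ℝ N q b 0 = -(N q 1 * fderiv ℝ θ q b) ∧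
      fderiv ℝ N q b 1 = N q 0 * fderiv ℝ θ q b := by
    intro b
    have h1 := hasDerivAt_line (h.differentiableAt_normal (hVU hq)) b
    have h2 := hasDerivAt_line
      ((hθ.contDiffAt (hV.mem_nhds hq)).differentiableAt (by simp)) b
    have h3 := eventually_line hV hq b
    have h4 := (h1.apply_R3 0).unique ((h2.cos.const_mul (Real.cosh ϑ)).congr_of_eventuallyEq
      (h3.mono fun t ht => (hN _ ht).1))
    have h5 := (h1.apply_R3 1).unique ((h2.sin.const_mul (Real.cosh ϑ)).congr_of_eventuallyEq
      (h3.mono fun t ht => (hN _ ht).2))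
    rw [h4, h5, (hN q hq).1, (hN q hq).2]
    simp only [zero_smul, add_zero]
    constructor <;> ring
  -- The structure equation is evaluated on T and JT. The derivative of θ along JT drops out, since
  -- the horizontal part of T is parallel to that of N.
  obtain ⟨b, hb⟩ := h.exists_fderiv_eq hE hϑ (hVU hq)
    (Y := cross τ (F q) (N q) (E3 - Real.sinh ϑ • N q)) (by
      rw [cross_zero hcn, cross_one hcn, contact_cross]; ring)
  have h1 := h.codazzi (hVU hq) a b
  rw [ha, hb, cross_zero hcn, cross_one hcn, vertical_sub_zero, vertical_sub_one,
    (hdN a).1, (hdN a).2, (hdN b).1, (hdN b).2] at h1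
  have h2 := h.sq_add_sq q (hVU hq)
  apply mul_left_cancel₀ (pow_ne_zero 2 hC)
  linear_combination -h1 + (2 * τ * Real.sinh ϑ ^ 2 - fderiv ℝ θ q a) * h2

/-- Coordinates whose first coordinate vector is the vertical tangent field. -/
theorem exists_vertical_coordinates {F N : R2 → R3} {U : Set R2} (h : IsHelixPatch τ ϑ F N U)
    (hτ : τ ≠ 0) (hϑ : ϑ ≠ 0) {q₀ : R2} (hq₀ : q₀ ∈ U) :
    ∃ Y : PartialDiffeomorph 𝓘(ℝ, ℝ × ℝ) 𝓘(ℝ, R2) (ℝ × ℝ) R2 ∞,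
      q₀ ∈ Y.target ∧ Y.target ⊆ U ∧ ∀ w ∈ Y.source,
        fderiv ℝ (fun w => F (Y w)) w (1, 0) = E3 - Real.sinh ϑ • N (Y w) ∧
        N (Y w) 0 = Real.cosh ϑ * Real.cos (2 * τ * Real.sinh ϑ ^ 2 * w.1) ∧
        N (Y w) 1 = Real.cosh ϑ * Real.sin (2 * τ * Real.sinh ϑ ^ 2 * w.1) := by
  have hE : Module.finrank ℝ R2 = 2 := by simp
  have hS : Real.sinh ϑ ≠ 0 := by simpa using hϑ
  have hC : Real.cosh ϑ ≠ 0 := (Real.cosh_pos ϑ).ne'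
  have hk : 2 * τ * Real.sinh ϑ ^ 2 ≠ 0 := by positivity
  have hNs := contDiffOn_R3_iff.1 h.smooth_normal
  have hFs := contDiffOn_R3_iff.1 h.smooth
  obtain ⟨V, θ, hV, hVU, hqV, hθ, hN⟩ := exists_smooth_angle h.isOpen (Real.cosh_pos ϑ)
    (hNs 0) (hNs 1) h.sq_add_sq hq₀
  set m : ℝ := Real.cosh ϑ / (2 * τ * Real.sinh ϑ) with hm
  set s₀ : ℝ := Real.sin (θ q₀) with hs₀
  set c₀ : ℝ := Real.cos (θ q₀) with hc₀
  -- With m = coth ϑ / (2τ), both x + m sin θ and y - m cos θ are constant along T. The chosen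
  -- combination measures displacement across the horizontal direction of T at q₀, so it completes
  -- θ/k to coordinates there.
  set H : R2 → ℝ × ℝ := fun q => (θ q / (2 * τ * Real.sinh ϑ ^ 2),
    s₀ * (F q 0 + m * Real.sin (θ q)) - c₀ * (F q 1 - m * Real.cos (θ q))) with hH
  have hHs : ContDiffOn ℝ ∞ H V :=
    (hθ.div_const _).prodMk
      ((contDiffOn_const.mul (((hFs 0).mono hVU).add (contDiffOn_const.mul hθ.sin))).sub
        (contDiffOn_const.mul (((hFs 1).mono hVU).sub (contDiffOn_const.mul hθ.cos))))
  have hdH : ∀ q ∈ V, ∀ a, fderiv ℝ H q a = (fderiv ℝ θ q a / (2 * τ * Real.sinh ϑ ^ 2),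
      s₀ * (fderiv ℝ F q a 0 + m * (Real.cos (θ q) * fderiv ℝ θ q a))
        - c₀ * (fderiv ℝ F q a 1 + m * (Real.sin (θ q) * fderiv ℝ θ q a))) := by
    intro q hq a
    have h1 := hasDerivAt_line (h.differentiableAt (hVU hq)) a
    have h2 := hasDerivAt_line
      ((hθ.contDiffAt (hV.mem_nhds hq)).differentiableAt (by simp)) a
    have h3 := hasDerivAt_line
      ((hHs.contDiffAt (hV.mem_nhds hq)).differentiableAt (by simp)) a
    refine h3.unique (((h2.div_const _).prodMk
      ((((h1.apply_R3 0).add (h2.sin.const_mul m)).const_mul s₀).sub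
        (((h1.apply_R3 1).sub (h2.cos.const_mul m)).const_mul c₀))).congr_deriv ?_)
    simp only [zero_smul, add_zero]
    congr 1
    ring
  have hT : ∀ q ∈ V, ∃ a, fderiv ℝ F q a = E3 - Real.sinh ϑ • N q ∧ fderiv ℝ H q a = (1, 0) := by
    intro q hq
    obtain ⟨a, ha⟩ := h.exists_fderiv_eq hE hϑ (hVU hq) (Y := E3 - Real.sinh ϑ • N q) (by
      rw [vertical_sub_zero, vertical_sub_one,
        contact_vertical_sub (h.contact_normal q (hVU hq))]
      linear_combination -Real.sinh ϑ * h.sq_add_sq q (hVU hq))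
    refine ⟨a, ha, ?_⟩
    rw [hdH q hq, h.fderiv_angle hE hϑ hV hVU hθ hN hq ha, ha, vertical_sub_zero,
      vertical_sub_one, (hN q hq).1, (hN q hq).2, div_self hk]
    congr 1
    rw [hm]
    field_simp
    ring
  have hinj : Function.Injective (fderiv ℝ H q₀) := by
    rw [injective_iff_map_eq_zero]
    intro a ha
    rw [hdH q₀ hqV, Prod.mk_eq_zero] at ha
    obtain ⟨h1, h2⟩ := ha
    have hθa : fderiv ℝ θ q₀ a = 0 := by
      rcases div_eq_zero_iff.1 h1 with h1 | h1
      · exact h1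
      · exact absurd h1 hk
    rw [hθa] at h2
    obtain ⟨b, hb, hHb⟩ := hT q₀ hqV
    have hθb := h.fderiv_angle hE hϑ hV hVU hθ hN hqV hb
    have h3 := h.normal q₀ hq₀ a
    obtain ⟨hN0, hN1⟩ := hN q₀ hqV
    have hsc := Real.sin_sq_add_cos_sq (θ q₀)
    rw [← hs₀, ← hc₀] at hsc
    rw [← hc₀] at hN0
    rw [← hs₀] at hN1
    set x := fderiv ℝ F q₀ a 0
    set y := fderiv ℝ F q₀ a 1
    -- With dθ(a) = 0, the second component of dH(a) = 0 says that the horizontal part of dF(a) is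
    -- (c₀x + s₀y)(c₀, s₀), while that of T is -sinh ϑ cosh ϑ (c₀, s₀). So dF(a) is a multiple of T,
    -- and T(θ) = k ≠ 0 forces the multiple to vanish.
    have hab : fderiv ℝ F q₀ a
        = fderiv ℝ F q₀ ((-(c₀ * x + s₀ * y) / (Real.sinh ϑ * Real.cosh ϑ)) • b) := by
      rw [map_smul, hb]
      apply ext_frame (τ := τ) (p := F q₀)
      · rw [PiLp.smul_apply, vertical_sub_zero, hN0, smul_eq_mul]
        change x = _
        field_simp
        linear_combination -x * hsc + s₀ * h2
      · rw [PiLp.smul_apply, vertical_sub_one, hN1, smul_eq_mul]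
        change y = _
        field_simp
        linear_combination -y * hsc - c₀ * h2
      · rw [contact_smul, contact_vertical_sub (h.contact_normal q₀ hq₀)]
        apply mul_left_cancel₀ hS
        rw [hN0, hN1] at h3
        field_simp
        linear_combination h3
    have hab' := h.injective q₀ hq₀ hab
    have h4 := congrArg (fderiv ℝ θ q₀) hab'
    rw [map_smul, hθa, hθb, smul_eq_mul] at h4
    rcases mul_eq_zero.1 h4.symm with h5 | h5
    · rw [hab', h5, zero_smul]
    · exact absurd h5 hk
  obtain ⟨Y, hY1, hY2, hY3, hY4⟩ := exists_local_inverse (by simp) hV hHs hqV hinj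
  refine ⟨Y, hY1, hY2.trans hVU, fun w hw => ?_⟩
  have hYw : Y w ∈ V := hY2 (Y.map_source hw)
  obtain ⟨a, ha, hHa⟩ := hT (Y w) hYw
  have h1 := hY4 F w hw (h.differentiableAt (hVU hYw)) a
  rw [hHa, ha] at h1
  have h2 : θ (Y w) = 2 * τ * Real.sinh ϑ ^ 2 * w.1 := by
    have := congrArg Prod.fst (hY3 w hw)
    simp only [hH] at this
    rw [← this]
    field_simp
  exact ⟨h1, h2 ▸ hN (Y w) hYw⟩

end IsHelixPatch

/-! ### Normalizing the second coordinate vector. -/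

namespace IsVerticalPatch

variable {τ ϑ : ℝ} {F N : ℝ × ℝ → R3} {I J : Set ℝ}

/-- The horizontal part of the second coordinate vector does not depend on the first coordinate. -/
theorem snd_eq (h : IsVerticalPatch τ ϑ F N (I ×ˢ J)) (hI : IsOpen I) (hI' : I.OrdConnected)
    (hτ : τ ≠ 0) (hϑ : ϑ ≠ 0) {u u₀ v : ℝ} (hu : u ∈ I) (hu₀ : u₀ ∈ I) (hv : v ∈ J) :
    fderiv ℝ F (u, v) (0, 1) 0 = fderiv ℝ F (u₀, v) (0, 1) 0 ∧
    fderiv ℝ F (u, v) (0, 1) 1 = fderiv ℝ F (u₀, v) (0, 1) 1 := by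
  -- In the explicit integrals for x and y the trigonometric terms do not involve v, so
  -- differentiating in v removes them.
  have key : ∀ s ∈ J, _ := fun s hs => h.integrate_fst hI hI' hτ hϑ (c := 0) (u := u) (u₀ := u₀)
    (v := s)
    (fun u hu v hv => h.fst_eq (u, v) ⟨hu, hv⟩)
    (fun u hu v hv => by
      rw [add_zero]
      exact ⟨h.normal_zero (u, v) ⟨hu, hv⟩, h.normal_one (u, v) ⟨hu, hv⟩⟩) hu hu₀ hs
  have hJ : ∀ᶠ s in nhds v, s ∈ J :=
    Filter.eventually_of_mem ((h.isOpen.preimage (Continuous.prodMk_right u)).mem_nhds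
      (show (u, v) ∈ I ×ˢ J from ⟨hu, hv⟩)) fun s hs => hs.2
  have h1 := hasDerivAt_snd (h.differentiableAt (q := (u, v)) ⟨hu, hv⟩)
  have h2 := hasDerivAt_snd (h.differentiableAt (q := (u₀, v)) ⟨hu₀, hv⟩)
  exact ⟨((h1.apply_R3 0).add_const _).unique (((h2.apply_R3 0).add_const _).congr_of_eventuallyEq
      (hJ.mono fun s hs => (key s hs).1)),
    ((h1.apply_R3 1).sub_const _).unique (((h2.apply_R3 1).sub_const _).congr_of_eventuallyEq
      (hJ.mono fun s hs => (key s hs).2))⟩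

/-- The second coordinate vector has a nonzero horizontal part. -/
theorem snd_horizontal_pos (h : IsVerticalPatch τ ϑ F N (I ×ˢ J)) (hϑ : ϑ ≠ 0) {w : ℝ × ℝ}
    (hw : w ∈ I ×ˢ J) :
    0 < fderiv ℝ F w (0, 1) 0 ^ 2 + fderiv ℝ F w (0, 1) 1 ^ 2 := by
  have hS : Real.sinh ϑ ≠ 0 := by simpa using hϑ
  by_contra hcon
  have h0 : fderiv ℝ F w (0, 1) 0 = 0 := by nlinarith
  have h1 : fderiv ℝ F w (0, 1) 1 = 0 := by nlinarith
  have h2 := h.normal w hw (0, 1)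
  rw [h0, h1] at h2
  have h3 : contact τ (F w) (fderiv ℝ F w (0, 1)) = 0 := by
    have h4 : Real.sinh ϑ * contact τ (F w) (fderiv ℝ F w (0, 1)) = 0 := by linarith
    exact (mul_eq_zero.1 h4).resolve_left hS
  have h5 : fderiv ℝ F w (0, 1) = fderiv ℝ F w 0 := by
    rw [map_zero]
    exact ext_frame (τ := τ) (p := F w) h0 h1 (by rw [h3]; simp [contact])
  have h6 := h.injective w hw h5
  simp at h6

/-- Reparametrization of the second coordinate by the arc length of the horizontal projection. -/
theorem exists_arclength_coordinates (h : IsVerticalPatch τ ϑ F N (I ×ˢ J)) (hI : IsOpen I)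
    (hI' : I.OrdConnected) (hJ : IsOpen J) (hJ' : J.OrdConnected) (hτ : τ ≠ 0) (hϑ : ϑ ≠ 0)
    {w₀ : ℝ × ℝ} (hw₀ : w₀ ∈ I ×ˢ J) :
    ∃ Y : PartialDiffeomorph 𝓘(ℝ, ℝ × ℝ) 𝓘(ℝ, ℝ × ℝ) (ℝ × ℝ) (ℝ × ℝ) ∞,
      w₀ ∈ Y.target ∧ Y.target ⊆ I ×ˢ J ∧ ∀ w ∈ Y.source, (Y w).1 = w.1 ∧
        fderiv ℝ (fun w => F (Y w)) w (1, 0) = E3 - Real.sinh ϑ • N (Y w) ∧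
        fderiv ℝ (fun w => F (Y w)) w (0, 1) 0 ^ 2
          + fderiv ℝ (fun w => F (Y w)) w (0, 1) 1 ^ 2 = Real.cosh ϑ ^ 2 := by
  have hC : Real.cosh ϑ ≠ 0 := (Real.cosh_pos ϑ).ne'
  obtain ⟨u₀, v₀⟩ := w₀
  obtain ⟨hu₀ : u₀ ∈ I, hv₀ : v₀ ∈ J⟩ := hw₀
  -- The horizontal speed on one slice, divided by cosh ϑ; its primitive is the new second
  -- coordinate. By `snd_eq` the same speed serves for every u.
  set ρ : ℝ → ℝ := fun v => Real.sqrt (fderiv ℝ F (u₀, v) (0, 1) 0 ^ 2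
    + fderiv ℝ F (u₀, v) (0, 1) 1 ^ 2) / Real.cosh ϑ with hρ
  have hpos : ∀ v ∈ J, 0 < ρ v := fun v hv =>
    div_pos (Real.sqrt_pos.2 (h.snd_horizontal_pos hϑ (w := (u₀, v)) ⟨hu₀, hv⟩)) (Real.cosh_pos ϑ)
  have hsm : ContDiffOn ℝ ∞ (fun v => fderiv ℝ F (u₀, v) (0, 1)) J :=
    contDiffOn_slice (((contDiffOn_infty_iff_fderiv_of_isOpen h.isOpen).1 h.smooth).2.clm_apply
      contDiffOn_const) hu₀
  have hρs : ContDiffOn ℝ ∞ ρ J :=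
    ((((contDiffOn_R3_iff.1 hsm 0).pow 2).add ((contDiffOn_R3_iff.1 hsm 1).pow 2)).sqrt
      fun v hv => (h.snd_horizontal_pos hϑ (w := (u₀, v)) ⟨hu₀, hv⟩).ne').div_const _
  obtain ⟨g, hg, hg'⟩ := exists_primitive hJ hJ' hρs hv₀
  set H : ℝ × ℝ → ℝ × ℝ := fun w => (w.1, g w.2) with hH
  have hHs : ContDiffOn ℝ ∞ H (I ×ˢ J) :=
    contDiffOn_fst.prodMk (hg.comp contDiffOn_snd fun w hw => hw.2)
  have hdH : ∀ w ∈ I ×ˢ J, ∀ a, fderiv ℝ H w a = (a.1, ρ w.2 * a.2) := by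
    intro w hw a
    have h1 : HasFDerivAt H _ w :=
      hasFDerivAt_fst.prodMk ((hg' w.2 hw.2).hasFDerivAt.comp w hasFDerivAt_snd)
    rw [h1.fderiv]
    simp [mul_comm]
  have hinj : Function.Injective (fderiv ℝ H (u₀, v₀)) := by
    rw [injective_iff_map_eq_zero]
    intro a ha
    rw [hdH _ ⟨hu₀, hv₀⟩, Prod.mk_eq_zero] at ha
    exact Prod.ext ha.1 ((mul_eq_zero.1 ha.2).resolve_left (hpos v₀ hv₀).ne')
  obtain ⟨Y, hY1, hY2, hY3, hY4⟩ := exists_local_inverse rfl h.isOpen hHs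
    (show (u₀, v₀) ∈ I ×ˢ J from ⟨hu₀, hv₀⟩) hinj
  refine ⟨Y, hY1, hY2, fun w hw => ⟨?_, ?_, ?_⟩⟩
  · have h1 : (H (Y w)).1 = w.1 := congrArg Prod.fst (hY3 w hw)
    exact h1
  · have hYw : Y w ∈ I ×ˢ J := hY2 (Y.map_source hw)
    have h1 := hY4 F w hw (h.differentiableAt hYw) (1, 0)
    rw [hdH _ hYw, h.fst_eq _ hYw] at h1
    simpa using h1
  · have hYw : Y w ∈ I ×ˢ J := hY2 (Y.map_source hw)
    have hr := hpos _ hYw.2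
    have h1 := hY4 F w hw (h.differentiableAt hYw) ((ρ (Y w).2)⁻¹ • (0, 1))
    rw [hdH _ hYw, map_smul] at h1
    have h2 : (((ρ (Y w).2)⁻¹ • ((0 : ℝ), (1 : ℝ))).1,
        ρ (Y w).2 * ((ρ (Y w).2)⁻¹ • ((0 : ℝ), (1 : ℝ))).2) = (0, 1) := by
      simp [mul_inv_cancel₀ hr.ne']
    rw [h2] at h1
    obtain ⟨h3, h4⟩ := h.snd_eq hI hI' hτ hϑ hYw.1 hu₀ hYw.2
    have h5 : ρ (Y w).2 ^ 2 * Real.cosh ϑ ^ 2 = fderiv ℝ F (u₀, (Y w).2) (0, 1) 0 ^ 2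
        + fderiv ℝ F (u₀, (Y w).2) (0, 1) 1 ^ 2 := by
      rw [hρ, ← mul_pow, div_mul_cancel₀ _ hC, Real.sq_sqrt (by positivity)]
    rw [h1]
    simp only [PiLp.smul_apply, smul_eq_mul]
    rw [h3, h4]
    field_simp
    linear_combination -h5

/-- With arc length as second coordinate, the second coordinate vector has a smooth angle. -/
theorem exists_eta (h : IsVerticalPatch τ ϑ F N (I ×ˢ J)) (hI : IsOpen I)
    (hI' : I.OrdConnected) (hJ : IsOpen J) (hτ : τ ≠ 0) (hϑ : ϑ ≠ 0)
    (hG : ∀ w ∈ I ×ˢ J, fderiv ℝ F w (0, 1) 0 ^ 2 + fderiv ℝ F w (0, 1) 1 ^ 2 = Real.cosh ϑ ^ 2)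
    {u₀ v₀ : ℝ} (hu₀ : u₀ ∈ I) (hv₀ : v₀ ∈ J) :
    ∃ (K : Set ℝ) (η : ℝ → ℝ), K ⊆ J ∧ IsOpen K ∧ K.OrdConnected ∧ v₀ ∈ K ∧
      ContDiffOn ℝ ∞ η K ∧ ∀ u ∈ I, ∀ v ∈ K, fderiv ℝ F (u, v) (0, 1) =
        (-(Real.sin (η v - 2 * τ * Real.sinh ϑ ^ 2 * u) / Real.sinh ϑ)) •
            (E3 - Real.sinh ϑ • N (u, v))
          + Real.cos (η v - 2 * τ * Real.sinh ϑ ^ 2 * u) •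
            cross τ (F (u, v)) (N (u, v)) (E3 - Real.sinh ϑ • N (u, v)) := by
  have hS : Real.sinh ϑ ≠ 0 := by simpa using hϑ
  have hsm : ContDiffOn ℝ ∞ (fun v => fderiv ℝ F (u₀, v) (0, 1)) J :=
    contDiffOn_slice (((contDiffOn_infty_iff_fderiv_of_isOpen h.isOpen).1 h.smooth).2.clm_apply
      contDiffOn_const) hu₀
  -- With N of phase ku, the required form of ∂_v has horizontal part cosh ϑ (sin η, -cos η), whence
  -- the swapped components and the sign.
  obtain ⟨V, η, hV, hVJ, hvV, hη, hη'⟩ := exists_smooth_angle hJ (Real.cosh_pos ϑ)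
    (p := fun v => -fderiv ℝ F (u₀, v) (0, 1) 1) (q := fun v => fderiv ℝ F (u₀, v) (0, 1) 0)
    (contDiffOn_R3_iff.1 hsm 1).neg (contDiffOn_R3_iff.1 hsm 0)
    (fun v hv => by rw [← hG (u₀, v) ⟨hu₀, hv⟩]; ring) hv₀
  obtain ⟨K, hKV, hK, hK', hvK⟩ := exists_box_line hV hvV
  refine ⟨K, η, hKV.trans hVJ, hK, hK', hvK, hη.mono hKV, fun u hu v hv => ?_⟩
  have hw : (u, v) ∈ I ×ˢ J := ⟨hu, hVJ (hKV hv)⟩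
  have hcn := h.contact_normal (u, v) hw
  obtain ⟨h0, h1⟩ := h.snd_eq hI hI' hτ hϑ hu hu₀ (hVJ (hKV hv))
  obtain ⟨h2, h3⟩ := hη' v (hKV hv)
  rw [← h1] at h2
  rw [← h0] at h3
  have h4 := h.normal (u, v) hw (0, 1)
  have hN0 := h.normal_zero (u, v) hw
  have hN1 := h.normal_one (u, v) hw
  have hψ : η v = (η v - 2 * τ * Real.sinh ϑ ^ 2 * u) + 2 * τ * Real.sinh ϑ ^ 2 * u := by ring
  generalize η v - 2 * τ * Real.sinh ϑ ^ 2 * u = ψ at *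
  simp only at hN0 hN1
  rw [hψ, Real.cos_add] at h2
  rw [hψ, Real.sin_add] at h3
  have hsc := Real.sin_sq_add_cos_sq (2 * τ * Real.sinh ϑ ^ 2 * u)
  apply ext_frame (τ := τ) (p := F (u, v))
  · simp only [PiLp.add_apply, PiLp.smul_apply, smul_eq_mul, vertical_sub_zero, cross_zero hcn]
    rw [h3, hN0, hN1]
    field_simp
  · simp only [PiLp.add_apply, PiLp.smul_apply, smul_eq_mul, vertical_sub_one, cross_one hcn]
    rw [neg_eq_iff_eq_neg.1 h2, hN0, hN1]
    field_simp
    ring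
  · rw [contact_add, contact_smul, contact_smul, contact_cross, contact_vertical_sub hcn]
    -- Normality determines the vertical component from the horizontal ones because sinh ϑ ≠ 0.
    apply mul_left_cancel₀ hS
    rw [neg_eq_iff_eq_neg.1 h2, h3, hN0, hN1] at h4
    field_simp
    linear_combination h4 - Real.cosh ϑ ^ 2 * Real.sin ψ * hsc

end IsVerticalPatch

/-! ### Adapted coordinates on the surface. -/

namespace IsTimelikeHelixSurface

variable {M : Type*} [TopologicalSpace M] [ChartedSpace R2 M] {τ ϑ : ℝ} {Φ N : M → R3}

theorem exists_vertical_coordinates [IsManifold 𝓘(ℝ, R2) ∞ M]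
    (hM : IsTimelikeHelixSurface τ ϑ Φ N) (hτ : τ ≠ 0) (hϑ : ϑ ≠ 0) (p : M) :
    ∃ (I J : Set ℝ) (X : PartialDiffeomorph 𝓘(ℝ, ℝ × ℝ) 𝓘(ℝ, R2) (ℝ × ℝ) M ∞) (w₀ : ℝ × ℝ),
      IsOpen I ∧ IsOpen J ∧ I.OrdConnected ∧ J.OrdConnected ∧ X.source = I ×ˢ J ∧
      w₀ ∈ I ×ˢ J ∧ X w₀ = p ∧
      IsVerticalPatch τ ϑ (fun w => Φ (X w)) (fun w => N (X w)) (I ×ˢ J) := by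
  let Z : PartialDiffeomorph 𝓘(ℝ, R2) 𝓘(ℝ, R2) R2 M ∞ :=
    { toPartialEquiv := (chartAt R2 p).symm.toPartialEquiv
      open_source := (chartAt R2 p).open_target
      open_target := (chartAt R2 p).open_source
      contMDiffOn_toFun := contMDiffOn_chart_symm
      contMDiffOn_invFun := contMDiffOn_chart }
  have hq₀ : chartAt R2 p p ∈ Z.source := (chartAt R2 p).map_source (mem_chart_source R2 p)
  have hZ : Z (chartAt R2 p p) = p := (chartAt R2 p).left_inv (mem_chart_source R2 p)
  obtain ⟨Y, hY1, hY2, hY3⟩ := (hM.isHelixPatch Z).exists_vertical_coordinates hτ hϑ hq₀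
  have hsrc : Y.source ⊆ (Y.trans Z).source := fun w hw => ⟨hw, hY2 (Y.map_source hw)⟩
  have hw₀ := Y.map_target hY1
  obtain ⟨I, J, hI, hJ, hI', hJ', hw, hIJ⟩ := exists_box Y.open_source hw₀
  obtain ⟨X, hXs, hX⟩ := exists_restrict (Y.trans Z) (hI.prod hJ) (hIJ.trans hsrc)
  have hX' : ∀ w, X w = Z (Y w) := hX
  refine ⟨I, J, X, _, hI, hJ, hI', hJ', hXs, hw, ?_, ?_⟩
  · rw [hX']
    exact (congrArg Z (Y.right_inv hY1)).trans hZ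
  · have hpatch := hM.isHelixPatch X
    rw [hXs] at hpatch
    refine ⟨hpatch, ?_, ?_, ?_⟩
    all_goals
      simp only [hX']
      intro w hw
      obtain ⟨h1, h2, h3⟩ := hY3 w (hIJ hw)
    · exact h1
    · exact h2
    · exact h3

theorem exists_arclength_coordinates [IsManifold 𝓘(ℝ, R2) ∞ M]
    (hM : IsTimelikeHelixSurface τ ϑ Φ N) (hτ : τ ≠ 0) (hϑ : ϑ ≠ 0) (p : M) :
    ∃ (I J : Set ℝ) (X : PartialDiffeomorph 𝓘(ℝ, ℝ × ℝ) 𝓘(ℝ, R2) (ℝ × ℝ) M ∞) (w₀ : ℝ × ℝ),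
      IsOpen I ∧ IsOpen J ∧ I.OrdConnected ∧ J.OrdConnected ∧ X.source = I ×ˢ J ∧
      w₀ ∈ I ×ˢ J ∧ X w₀ = p ∧
      IsVerticalPatch τ ϑ (fun w => Φ (X w)) (fun w => N (X w)) (I ×ˢ J) ∧
      ∀ w ∈ I ×ˢ J, fderiv ℝ (fun w => Φ (X w)) w (0, 1) 0 ^ 2
        + fderiv ℝ (fun w => Φ (X w)) w (0, 1) 1 ^ 2 = Real.cosh ϑ ^ 2 := by
  obtain ⟨A, B, Z, q₀, hA, hB, hA', hB', hZs, hq₀, hZ, hpZ⟩ :=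
    hM.exists_vertical_coordinates hτ hϑ p
  obtain ⟨Y, hY1, hY2, hY3⟩ := hpZ.exists_arclength_coordinates hA hA' hB hB' hτ hϑ hq₀
  have hsrc : Y.source ⊆ (Y.trans Z).source := fun w hw => ⟨hw, by
    change Y w ∈ Z.source
    rw [hZs]; exact hY2 (Y.map_source hw)⟩
  have hw₀ := Y.map_target hY1
  obtain ⟨I, J, hI, hJ, hI', hJ', hw, hIJ⟩ := exists_box Y.open_source hw₀
  obtain ⟨X, hXs, hX⟩ := exists_restrict (Y.trans Z) (hI.prod hJ) (hIJ.trans hsrc)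
  have hX' : ∀ w, X w = Z (Y w) := hX
  refine ⟨I, J, X, _, hI, hJ, hI', hJ', hXs, hw, ?_, ?_, ?_⟩
  · rw [hX']
    exact (congrArg Z (Y.right_inv hY1)).trans hZ
  · have hpatch := hM.isHelixPatch X
    rw [hXs] at hpatch
    refine ⟨hpatch, ?_, ?_, ?_⟩
    all_goals
      simp only [hX']
      intro w hw
      obtain ⟨h1, h2, -⟩ := hY3 w (hIJ hw)
      have hYw := hY2 (Y.map_source (hIJ hw))
    · exact h2
    -- The arc length change leaves the first coordinate fixed, so the phase of N keeps its form.
    · rw [← h1]; exact hpZ.normal_zero _ hYw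
    · rw [← h1]; exact hpZ.normal_one _ hYw
  · simp only [hX']
    exact fun w hw => (hY3 w (hIJ hw)).2.2

theorem exists_adaptedCoordinates [IsManifold 𝓘(ℝ, R2) ∞ M]
    (hM : IsTimelikeHelixSurface τ ϑ Φ N) (hτ : τ ≠ 0) (hϑ : ϑ ≠ 0) (p : M) :
    ∃ (I J : Set ℝ) (η : ℝ → ℝ) (X : PartialDiffeomorph 𝓘(ℝ, ℝ × ℝ) 𝓘(ℝ, R2) (ℝ × ℝ) M ∞),
      p ∈ X.target ∧ IsAdaptedCoordinates τ ϑ Φ N I J η X := by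
  obtain ⟨I, J, Z, w₀, hI, hJ, hI', hJ', hZs, hw₀, hZ, hpZ, hG⟩ :=
    hM.exists_arclength_coordinates hτ hϑ p
  obtain ⟨K, η, hKJ, hK, hK', hvK, hη, hK1⟩ :=
    hpZ.exists_eta hI hI' hJ hτ hϑ hG hw₀.1 hw₀.2
  have hsub : I ×ˢ K ⊆ I ×ˢ J := Set.prod_mono_right hKJ
  obtain ⟨X, hXs, hX⟩ := exists_restrict Z (hI.prod hK) (hZs ▸ hsub)
  refine ⟨I, K, η, X, ?_, hI, hK, hI', hK', hXs, hη, ?_, ?_⟩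
  · rw [← hZ, ← hX]
    exact X.map_source (by rw [hXs]; exact ⟨hw₀.1, hvK⟩)
  · intro u hu v hv
    rw [hM.tangentPart_eq]
    simp only [hX]
    exact hpZ.fst_eq (u, v) (hsub ⟨hu, hv⟩)
  · intro u hu v hv
    rw [hM.tangentPart_eq, hM.rotatedPart_eq]
    simp only [hX]
    exact hK1 u hu v hv

end IsTimelikeHelixSurface

end LorentzHeisenberg

end

theorem theorem2 {M : Type*} [TopologicalSpace M] [ChartedSpace R2 M]
    [IsManifold 𝓘(ℝ, R2) ∞ M] (τ ϑ : ℝ) (hτ : τ ≠ 0) (hϑ : ϑ ≠ 0) (Φ N : M → R3)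
    (hM : IsTimelikeHelixSurface τ ϑ Φ N) :
    (∀ p : M, ∃ (I J : Set ℝ) (η : ℝ → ℝ)
      (X : PartialDiffeomorph 𝓘(ℝ, ℝ × ℝ) 𝓘(ℝ, R2) (ℝ × ℝ) M ∞),
      p ∈ X.target ∧ IsAdaptedCoordinates τ ϑ Φ N I J η X) ∧
    (∀ (I J : Set ℝ) (η : ℝ → ℝ)
      (X : PartialDiffeomorph 𝓘(ℝ, ℝ × ℝ) 𝓘(ℝ, R2) (ℝ × ℝ) M ∞),
      IsAdaptedCoordinates τ ϑ Φ N I J η X →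
      ∃ (c : ℝ) (φ f₁ f₂ f₃ : ℝ → ℝ),
        (∀ u, φ u = 2 * τ * Real.sinh ϑ ^ 2 * u + c) ∧
        ContDiffOn ℝ ∞ f₁ J ∧ ContDiffOn ℝ ∞ f₂ J ∧ ContDiffOn ℝ ∞ f₃ J ∧
        (∀ v ∈ J, deriv f₁ v ^ 2 + deriv f₂ v ^ 2 = Real.cosh ϑ ^ 2) ∧
        (∀ v ∈ J, deriv f₃ v = τ * (f₂ v * deriv f₁ v - f₁ v * deriv f₂ v)) ∧
        (∀ u ∈ I, ∀ v ∈ J, Φ (X (u, v)) =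
          !₂[-(coth ϑ / (2 * τ)) * Real.sin (φ u) + f₁ v,
            coth ϑ / (2 * τ) * Real.cos (φ u) + f₂ v,
            Real.cosh ϑ ^ 2 / 2 * u
              - coth ϑ / 2 * (f₁ v * Real.cos (φ u) + f₂ v * Real.sin (φ u)) + f₃ v]) ∧
        (∀ s v : ℝ, (s - c) / (2 * τ * Real.sinh ϑ ^ 2) ∈ I → v ∈ J →
          Φ (X ((s - c) / (2 * τ * Real.sinh ϑ ^ 2), v)) =
          !₂[-(coth ϑ / (2 * τ)) * Real.sin s + f₁ v,
            coth ϑ / (2 * τ) * Real.cos s + f₂ v,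
            coth ϑ ^ 2 / (4 * τ) * s
              - coth ϑ / 2 * (f₁ v * Real.cos s + f₂ v * Real.sin s)
              + (f₃ v - coth ϑ ^ 2 / (4 * τ) * c)])) := by
  refine ⟨hM.exists_adaptedCoordinates hτ hϑ, fun I J η X hX => ?_⟩
  have hS : Real.sinh ϑ ≠ 0 := by simpa using hϑ
  suffices hmain : ∃ (c : ℝ) (f₁ f₂ f₃ : ℝ → ℝ),
      ContDiffOn ℝ ∞ f₁ J ∧ ContDiffOn ℝ ∞ f₂ J ∧ ContDiffOn ℝ ∞ f₃ J ∧
      (∀ v ∈ J, deriv f₁ v ^ 2 + deriv f₂ v ^ 2 = Real.cosh ϑ ^ 2) ∧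
      (∀ v ∈ J, deriv f₃ v = τ * (f₂ v * deriv f₁ v - f₁ v * deriv f₂ v)) ∧
      ∀ u ∈ I, ∀ v ∈ J, Φ (X (u, v)) =
        !₂[-(coth ϑ / (2 * τ)) * Real.sin (2 * τ * Real.sinh ϑ ^ 2 * u + c) + f₁ v,
          coth ϑ / (2 * τ) * Real.cos (2 * τ * Real.sinh ϑ ^ 2 * u + c) + f₂ v,
          Real.cosh ϑ ^ 2 / 2 * u
            - coth ϑ / 2 * (f₁ v * Real.cos (2 * τ * Real.sinh ϑ ^ 2 * u + c)
              + f₂ v * Real.sin (2 * τ * Real.sinh ϑ ^ 2 * u + c)) + f₃ v] by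
    obtain ⟨c, f₁, f₂, f₃, h1, h2, h3, h4, h5, h6⟩ := hmain
    refine ⟨c, fun u => 2 * τ * Real.sinh ϑ ^ 2 * u + c, f₁, f₂, f₃, fun _ => rfl, h1, h2, h3, h4,
      h5, h6, fun s v hs hv => ?_⟩
    have hk : 2 * τ * Real.sinh ϑ ^ 2 ≠ 0 := by positivity
    have e1 : 2 * τ * Real.sinh ϑ ^ 2 * ((s - c) / (2 * τ * Real.sinh ϑ ^ 2)) + c = s := by
      rw [mul_div_cancel₀ _ hk]; ring
    have e2 : Real.cosh ϑ ^ 2 / 2 * ((s - c) / (2 * τ * Real.sinh ϑ ^ 2))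
        = coth ϑ ^ 2 / (4 * τ) * s - coth ϑ ^ 2 / (4 * τ) * c := by
      rw [← coth_mul_sinh hϑ]
      field_simp
      ring
    rw [h6 _ hs v hv, e1, e2]
    congr 3
    ring_nf
  by_cases hne : I.Nonempty ∧ J.Nonempty
  · obtain ⟨⟨u₀, hu₀⟩, ⟨v₀, hv₀⟩⟩ := hne
    have h := hM.isHelixPatch X
    rw [hX.source_eq] at h
    refine h.exists_parametrization hX.isOpen_fst hX.isOpen_snd hX.ordConnected_fst
      hX.ordConnected_snd hτ hϑ (η := η) (fun u hu v hv => ?_) (fun u hu v hv => ?_) hu₀ hv₀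
    · rw [hX.partial_u u hu v hv, hM.tangentPart_eq]
    · rw [hX.partial_v u hu v hv, hM.rotatedPart_eq, hM.tangentPart_eq]
  -- The box is empty, but J may be nonempty when I is empty. A straight line of speed cosh ϑ still
  -- meets the conditions on f₁, f₂, f₃ over J.
  · have hd : ∀ v : ℝ, HasDerivAt (fun v => Real.cosh ϑ * v) (Real.cosh ϑ) v := fun v => by
      simpa using (hasDerivAt_id v).const_mul (Real.cosh ϑ)
    refine ⟨0, fun v => Real.cosh ϑ * v, fun _ => 0, fun _ => 0,
      contDiffOn_const.mul contDiffOn_id, contDiffOn_const, contDiffOn_const,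
      fun v _ => ?_, fun v _ => ?_, fun u hu v hv => absurd ⟨⟨u, hu⟩, ⟨v, hv⟩⟩ hne⟩
    · rw [(hd v).deriv]; simp
    · simp
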